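/- Setting. Let $H$ be a finite multigraph in which every vertex has degree at least one. The body-bar graph $G_H$ has one vertex for each end of an edge of $H$ (so each $v\in V(H)$ is replaced by a set $B_v$ of $\deg_H(v)$ vertices); two distinct vertices are adjacent iff they belong to the same $B_v$ (so $B_v$ is a complete graph, a "body") or are the two ends of the same edge of $H$ (a "bar"). Let $d\ge 0$ and let $\langle a,b\rangle_{\mathbb E}$ be the Euclidean inner product. On $\mathbb R^{d+1}$ also let $\langle a,b\rangle_{\mathbb M}=a_1b_1+\dots+a_db_d-a_{d+1}b_{d+1}$. Put $\mathbb S^d_+=\{a\in\mathbb R^{d+1}:\langle a,a\rangle_{\mathbb E}=1,\ a_{d+1}>0\}$ and $\mathbb H^d=\{a\in\mathbb R^{d+1}:\langle a,a\rangle_{\mathbb M}=-1,\ a_{d+1}>0\}$, and let $\pi(a)=(a_1/a_{d+1},\dots,a_d/a_{d+1})$. Let $S$ be a subgroup of the orthogonal group $O(d)$ and $S^*=\{x^*:x\in S\}$, where $x^*$ acts on $\mathbb R^{d+1}$ by $\operatorname{diag}(x,1)$. A framework $(G,p)$ with symmetry group $T$ is an injective map $p$ from $V(G)$ to the space together with a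 homomorphism $\Phi:T\to\mathrm{Aut}(G)$ (its type, determined by $p$) such that $x(p_i)=p_{\Phi(x)(i)}$ for all $x\in T$, $i\in V(G)$. A family $(u_i)_{i\in V(G)}$ of vectors is $T$-symmetric if $x(u_i)=u_{\Phi(x)(i)}$ for all $x\in T$, $i\in V(G)$. Infinitesimal motions. In $\mathbb E^d$, an infinitesimal motion of $(G,p)$ is $u:V(G)\to\mathbb R^d$ with $\langle p_i-p_j,u_i-u_j\rangle_{\mathbb E}=0$ for every edge $\{i,j\}$; it is trivial if $u_i=Ap_i+t$ for all $i$, for some skew-symmetric $A$ and vector $t$. In $\mathbb S^d_+$ (respectively $\mathbb H^d$), writing $\langle\cdot,\cdot\rangle$ for $\langle\cdot,\cdot\rangle_{\mathbb E}$ (respectively $\langle\cdot,\cdot\rangle_{\mathbb M}$), an infinitesimal motion of $(G,q)$ is $v:V(G)\to\mathbb R^{d+1}$ with $\langle q_i,v_i\rangle=0$ for every $i$ and $\langle q_i-q_j,v_i-v_j\rangle=0$ for every edge $\{i,j\}$; it is trivial if $v_i=Aq_i$ for all $i$, for some linear $A$ with $\langle Aa,b\rangle=-\langle a,Ab\rangle$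 for all $a,b$. Finite flexes. In each of the three spaces, a symmetric finite flex of $(G,p)$ is an analytic path $x:[0,1]\to(\text{space})^{V(G)}$ with $x(0)=p$ such that every $x(t)$ is symmetric (for the symmetry group and type of the framework); for every $t\in[0,1]$ and every edge $\{i,j\}$ the squared length $\langle x_i(t)-x_j(t),x_i(t)-x_j(t)\rangle$ equals its value at $t=0$; and for every $t\in(0,1]$ this fails for some pair $i\ne j$ of vertices. Regularity. Let $(G,p)$ have type $\Phi$ in $\mathbb E^d$ and let $\mathscr P$ be the linear space of all $y\in(\mathbb R^d)^{V(G)}$ with $x(y_i)=y_{\Phi(x)(i)}$ for all $x\in S$, $i\in V(G)$. Let $\tilde f:\mathscr P\to\mathbb R^{E(G)}$, $\tilde f(y)=(\|y_i-y_j\|^2)_{\{i,j\}\in E(G)}$. The point $p$ is $S$-regular if $\operatorname{rank} d\tilde f(p)=\max_{y\in\mathscr P}\operatorname{rank} d\tilde f(y)$. Theorem. Let $(G_H,p)$ be a body-bar framework with symmetry group $S$ in $\mathbb E^d$, let $(G_H,q)$ be a body-bar framework with symmetry group $S^*$ in $\mathbb S^d_+$ with $\pi(q)=p$, and let $(G_H,r)$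 be a body-bar framework with symmetry group $S^*$ in $\mathbb H^d$ with $\pi(r)=p$. The following are equivalent: (i) $(G_H,p)$ has a non-trivial $S$-symmetric infinitesimal motion in $\mathbb E^d$; (ii) $(G_H,q)$ has a non-trivial $S^*$-symmetric infinitesimal motion in $\mathbb S^d_+$; (iii) $(G_H,r)$ has a non-trivial $S^*$-symmetric infinitesimal motion in $\mathbb H^d$. If moreover $p$ is an $S$-regular point of $G_H$, then the following are equivalent: (i) $(G_H,p)$ has an $S$-symmetric finite flex in $\mathbb E^d$; (ii) $(G_H,q)$ has an $S^*$-symmetric finite flex in $\mathbb S^d_+$; (iii) $(G_H,r)$ has an $S^*$-symmetric finite flex in $\mathbb H^d$. -/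

import Mathlib

noncomputable section

namespace SymFramework

/-- The coordinate space of dimension `m`, with its Euclidean structure. -/
abbrev E (m : ℕ) : Type := EuclideanSpace ℝ (Fin m)

/-- The Euclidean inner product, as a bilinear form. -/
def euclidForm (m : ℕ) : E m →ₗ[ℝ] E m →ₗ[ℝ] ℝ := innerₗ (E m)

/-- The Minkowskian bilinear form `a₁ b₁ + ⋯ + a_d b_d - a_{d+1} b_{d+1}`. -/
def minkForm (d : ℕ) : E (d + 1) →ₗ[ℝ] E (d + 1) →ₗ[ℝ] ℝ :=
  LinearMap.mk₂ ℝ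
    (fun a b => ∑ k : Fin d, a k.castSucc * b k.castSucc - a (Fin.last d) * b (Fin.last d))
    (fun a a' b => by simp only [PiLp.add_apply, add_mul, Finset.sum_add_distrib]; ring)
    (fun c a b => by
      simp only [PiLp.smul_apply, smul_eq_mul, mul_assoc, ← Finset.mul_sum]; ring)
    (fun a b b' => by simp only [PiLp.add_apply, mul_add, Finset.sum_add_distrib]; ring)
    (fun c a b => by
      simp only [PiLp.smul_apply, smul_eq_mul, mul_left_comm _ c, ← Finset.mul_sum]; ring)

/-- The open upper half of the unit sphere. -/
def hemisphere (d : ℕ) : Set (E (d + 1)) :=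
  {a | euclidForm (d + 1) a a = 1 ∧ 0 < a (Fin.last d)}

/-- Hyperbolic space: the upper sheet of the hyperboloid `a₁² + ⋯ + a_d² - a_{d+1}² = -1`. -/
def hyperbolicSpace (d : ℕ) : Set (E (d + 1)) :=
  {a | minkForm d a a = -1 ∧ 0 < a (Fin.last d)}

/-- Central projection from the origin onto the hyperplane `a_{d+1} = 1`, identified with `E d`. -/
def centralProj (d : ℕ) (a : E (d + 1)) : E d :=
  WithLp.toLp 2 fun k => a k.castSucc / a (Fin.last d)

/-! ### Symmetry groups -/

/-- `(a₁, …, a_d, a_{d+1}) ↦ (x (a₁, …, a_d), a_{d+1})`. -/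
def extendFun {d : ℕ} (x : E d → E d) (a : E (d + 1)) : E (d + 1) :=
  WithLp.toLp 2 (Fin.snoc (α := fun _ => ℝ)
    (x (WithLp.toLp 2 fun k => a k.castSucc)) (a (Fin.last d)))

lemma extendFun_castSucc {d : ℕ} (x : E d → E d) (a : E (d + 1)) (k : Fin d) :
    extendFun x a k.castSucc = x (WithLp.toLp 2 fun k => a k.castSucc) k := by
  simp [extendFun]

lemma extendFun_last {d : ℕ} (x : E d → E d) (a : E (d + 1)) :
    extendFun x a (Fin.last d) = a (Fin.last d) := by
  simp [extendFun]

lemma extendFun_comp {d : ℕ} (x y : E d → E d) (a : E (d + 1)) :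
    extendFun x (extendFun y a) = extendFun (x ∘ y) a := by
  ext k
  refine Fin.lastCases ?_ (fun k => ?_) k
  · simp only [extendFun_last]
  · rw [extendFun_castSucc, extendFun_castSucc]
    simp only [extendFun_castSucc, Function.comp]

lemma extendFun_id {d : ℕ} (a : E (d + 1)) : extendFun (id : E d → E d) a = a := by
  ext k
  refine Fin.lastCases ?_ (fun k => ?_) k
  · rw [extendFun_last]
  · rw [extendFun_castSucc]; rfl

/-- The extension `x*` of an orthogonal transformation `x`, with block matrix `diag(x, 1)`. -/
def star {d : ℕ} (x : E d ≃ₗᵢ[ℝ] E d) : E (d + 1) ≃ₗᵢ[ℝ] E (d + 1) where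
  toFun := extendFun x
  invFun := extendFun x.symm
  left_inv a := by
    rw [extendFun_comp, show (x.symm : E d → E d) ∘ x = id from funext fun b => by simp,
      extendFun_id]
  right_inv a := by
    rw [extendFun_comp, show (x : E d → E d) ∘ x.symm = id from funext fun b => by simp,
      extendFun_id]
  map_add' a b := by
    ext k
    refine Fin.lastCases ?_ (fun k => ?_) k
    · simp only [PiLp.add_apply, extendFun_last]
    · simp only [PiLp.add_apply, extendFun_castSucc]
      rw [← PiLp.add_apply, ← map_add]; rfl
  map_smul' c a := by
    ext k
    refine Fin.lastCases ?_ (fun k => ?_) k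
    · simp only [PiLp.smul_apply, extendFun_last, RingHom.id_apply]
    · simp only [PiLp.smul_apply, extendFun_castSucc, RingHom.id_apply]
      rw [← PiLp.smul_apply, ← map_smul]; rfl
  norm_map' a := by
    change ‖extendFun x a‖ = ‖a‖
    have h := x.norm_map (WithLp.toLp 2 fun k => a k.castSucc)
    rw [← sq_eq_sq₀ (norm_nonneg _) (norm_nonneg _)] at h ⊢
    rw [EuclideanSpace.norm_sq_eq, EuclideanSpace.norm_sq_eq] at h ⊢
    rw [Fin.sum_univ_castSucc, Fin.sum_univ_castSucc]
    simp only [extendFun_last, extendFun_castSucc]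
    rw [h]

/-- `x ↦ x*` as a group homomorphism. -/
def starHom (d : ℕ) : (E d ≃ₗᵢ[ℝ] E d) →* (E (d + 1) ≃ₗᵢ[ℝ] E (d + 1)) where
  toFun := star
  map_one' := by ext1 a; exact extendFun_id a
  map_mul' x y := by ext1 a; exact (extendFun_comp x y a).symm

/-- The group `S* = {x* : x ∈ S}`. -/
def starGroup {d : ℕ} (S : Subgroup (E d ≃ₗᵢ[ℝ] E d)) :
    Subgroup (E (d + 1) ≃ₗᵢ[ℝ] E (d + 1)) :=
  S.map (starHom d)

section Frameworks

variable {V : Type*} {G : SimpleGraph V} {m : ℕ} {S : Subgroup (E m ≃ₗᵢ[ℝ] E m)}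

/-- A vector assignment `w` on the vertices (a configuration, or a field of velocities) is
symmetric with respect to `Φ : S → Aut(G)` if `x (w i) = w (Φ(x) i)` for all `x ∈ S` and all
vertices `i`. -/
def IsSymmetric (Φ : S →* (G ≃g G)) (w : V → E m) : Prop :=
  ∀ (x : S) (i : V), (x : E m ≃ₗᵢ[ℝ] E m) (w i) = w (Φ x i)

/-- `(G, p)` is a framework (its joints are distinct) with symmetry group `S`, of type `Φ`. -/
def IsFramework (Φ : S →* (G ≃g G)) (p : V → E m) : Prop :=
  Function.Injective p ∧ IsSymmetric Φ p

/-- The space of all configurations that satisfy the symmetry equations of type `Φ`. -/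
def symConfigs (Φ : S →* (G ≃g G)) : Submodule ℝ (V → E m) where
  carrier := {p | IsSymmetric Φ p}
  zero_mem' := fun x i => by simp
  add_mem' := fun hp hq x i => by simp [hp x i, hq x i]
  smul_mem' := fun c p hp x i => by simp [hp x i]

/-! ### Edge functions, finite flexes and regular points -/

/-- The edge function of `G` for the bilinear form `B`: the squared lengths of all bars. -/
def edgeFunction (B : E m →ₗ[ℝ] E m →ₗ[ℝ] ℝ) (G : SimpleGraph V) (p : V → E m) :
    G.edgeSet → ℝ :=
  fun e => Sym2.lift ⟨fun i j => B (p i - p j) (p i - p j), fun i j => by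
    dsimp only
    rw [← neg_sub (p j) (p i)]; simp only [map_neg, LinearMap.neg_apply, neg_neg]⟩ e.1

/-- `x` is a finite flex of `(G, p)` in the space `M`, with squared lengths measured by `B`: an
analytic path of configurations in `M` that starts at `p`, preserves the lengths of all bars, and
is not congruent to `p` at any positive time. -/
structure IsFiniteFlex (M : Set (E m)) (B : E m →ₗ[ℝ] E m →ₗ[ℝ] ℝ) (G : SimpleGraph V)
    (p : V → E m) (x : ℝ → V → E m) : Prop where
  analytic : ∀ i, AnalyticOn ℝ (fun t => x t i) (Set.Icc 0 1)
  start : x 0 = p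
  mem : ∀ t ∈ Set.Icc (0 : ℝ) 1, ∀ i, x t i ∈ M
  bars : ∀ t ∈ Set.Icc (0 : ℝ) 1, edgeFunction B G (x t) = edgeFunction B G p
  nontrivial : ∀ t ∈ Set.Ioc (0 : ℝ) 1,
    edgeFunction B (⊤ : SimpleGraph V) (x t) ≠ edgeFunction B (⊤ : SimpleGraph V) p

/-- `(G, p)` has a finite flex in `M` that is symmetric (of type `Φ`) at all times. -/
def HasSymmetricFiniteFlex (M : Set (E m)) (B : E m →ₗ[ℝ] E m →ₗ[ℝ] ℝ) (Φ : S →* (G ≃g G))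
    (p : V → E m) : Prop :=
  ∃ x : ℝ → V → E m, IsFiniteFlex M B G p x ∧ ∀ t ∈ Set.Icc (0 : ℝ) 1, IsSymmetric Φ (x t)

/-- The rank, at the configuration `p`, of the derivative of the Euclidean edge function
restricted to the space of symmetric configurations. -/
def symRank (Φ : S →* (G ≃g G)) (p : symConfigs Φ) : ℕ :=
  Module.finrank ℝ (LinearMap.range
    (fderiv ℝ (fun y : symConfigs Φ => edgeFunction (euclidForm m) G (y : V → E m)) p).toLinearMap)

/-- `p` is an `S`-regular point of `G` (with respect to the type `Φ`) in Euclidean space. -/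
def IsSRegular (Φ : S →* (G ≃g G)) (p : V → E m) : Prop :=
  ∃ hp : p ∈ symConfigs Φ, ∀ q : symConfigs Φ, symRank Φ q ≤ symRank Φ ⟨p, hp⟩

/-! ### Infinitesimal motions -/

/-- `u` preserves the lengths of all bars of `(G, p)` to first order, with respect to `B`. -/
def IsInfMotion (B : E m →ₗ[ℝ] E m →ₗ[ℝ] ℝ) (G : SimpleGraph V) (p u : V → E m) : Prop :=
  ∀ i j, G.Adj i j → B (p i - p j) (u i - u j) = 0

/-- `A` is skew-symmetric with respect to `B` (an infinitesimal rotation of the form `B`). -/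
def IsSkew (B : E m →ₗ[ℝ] E m →ₗ[ℝ] ℝ) (A : E m →ₗ[ℝ] E m) : Prop :=
  ∀ a b, B (A a) b = -B a (A b)

/-- `(G, p)` has a non-trivial symmetric infinitesimal motion in Euclidean space; the trivial ones
are `u i = A (p i) + t` with `A` skew-symmetric. -/
def HasSymmetricInfFlex (Φ : S →* (G ≃g G)) (p : V → E m) : Prop :=
  ∃ u : V → E m, IsInfMotion (euclidForm m) G p u ∧ IsSymmetric Φ u ∧
    ¬ ∃ (A : E m →ₗ[ℝ] E m) (t : E m), IsSkew (euclidForm m) A ∧ ∀ i, u i = A (p i) + t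

/-- `(G, q)`, with joints on a sphere `B a a = const` of the form `B`, has a non-trivial symmetric
infinitesimal motion within that sphere: velocities are tangent to the sphere (the distances to
the centre, which stays at the origin, are preserved to first order), and the trivial motions are
`v i = A (q i)` with `A` an infinitesimal rotation of `B`. -/
def HasSymmetricInfFlexOnSphere (B : E m →ₗ[ℝ] E m →ₗ[ℝ] ℝ) (Φ : S →* (G ≃g G))
    (q : V → E m) : Prop :=
  ∃ v : V → E m, IsInfMotion B G q v ∧ (∀ i, B (q i) (v i) = 0) ∧ IsSymmetric Φ v ∧
    ¬ ∃ A : E m →ₗ[ℝ] E m, IsSkew B A ∧ ∀ i, v i = A (q i)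

end Frameworks

/-! ### Body-bar graphs -/

/-- The vertices of the body-bar graph: one for each end `(v, e)` of an edge `e` of `H`. The
Boolean is `false`, except that a loop `e` at `v` has a second end `(v, e, true)`. Hence exactly
`deg v` of them have first component `v`. -/
def EdgeEnd {α β : Type*} (H : Graph α β) : Type _ :=
  {z : α × β × Bool // H.Inc z.2.1 z.1 ∧ (z.2.2 = true → H.IsLoopAt z.2.1 z.1)}

/-- The body-bar graph induced by the multigraph `H`: the ends at a common vertex form a complete
graph (a body), and the two ends of each edge of `H` are joined (by a bar). -/
def bodyBarGraph {α β : Type*} (H : Graph α β) : SimpleGraph (EdgeEnd H) where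
  Adj y z := y ≠ z ∧ (y.1.1 = z.1.1 ∨ y.1.2.1 = z.1.2.1)
  symm := ⟨fun _ _ h => ⟨h.1.symm, h.2.imp Eq.symm Eq.symm⟩⟩
  loopless := ⟨fun _ h => h.1 rfl⟩

end SymFramework

end

noncomputable section

namespace SymFramework

open Filter Topology
open scoped ContDiff

/-! ### Level sets at points of maximal rank -/

/-! Central projection carries all three spaces to `E d`. The open hemisphere becomes all of `E d`
and hyperbolic space becomes the open unit ball, so a single parameter `σ` (0, 1 or -1) and the
condition `0 < 1 + σ * ‖y‖ ^ 2` describe every case. The projection intertwines `x*` with `x`, and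
injectivity of `p` forces the types to agree. It remains to compare the squared distances
`liftSqDist σ` on the same configurations.

Infinitesimally, a pointwise linear bijection of velocities (`euclidVel`, inverse `modelVel`) turns
the derivative of `liftSqDist σ` into the Euclidean first-order condition times a positive factor
(`hasDerivAt_liftSqDist`). Hence infinitesimal motions correspond for all `σ`. Trivial motions
correspond because a skew map of the form on `E (d + 1)` consists of a skew map of `E d` and a
translation vector (`exists_skew_liftVel_iff`). The symmetric edge functions also have equal rank
for all `σ`, so an `S`-regular point has maximal rank in each model.

For finite flexes, each model flex is equivalent to the same Euclidean infinitesimal flex. Given the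
infinitesimal flex, maximal rank yields an analytic path in the fibre of the edge function with the
prescribed velocity (`exists_analytic_path_in_fiber`). By analyticity it is either congruent to the
start for all small times or for no small nonzero time. The first case makes the initial velocity
trivial (`exists_trivial_of_congruent_path`). For this, preserving all pairwise distances to first
order is not enough when the joints fail to span affinely, so affine relations among the joints are
tracked as well.

Conversely, if all symmetric infinitesimal motions at `p` are trivial, they come from infinitesimal
isometries commuting with `S` (`exists_invariant_generator`). Restricted to nearby symmetric
configurations, these still span the kernel, because rank is lower semicontinuous. So along a flex
every pairwise distance has zero derivative near the start, which contradicts non-congruence. -/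

/-- If the rank of the derivative of the analytic map `f` is maximal at `p`, then every vector
in the kernel of the derivative is the velocity of an analytic path in the level set of `f`. -/
theorem exists_analytic_path_in_fiber {P F : Type*} [NormedAddCommGroup P] [NormedSpace ℝ P]
    [FiniteDimensional ℝ P] [NormedAddCommGroup F] [NormedSpace ℝ F] [FiniteDimensional ℝ F]
    {f : P → F} {p : P} (hf : ContDiffAt ℝ ω f p)
    (hrank : ∀ᶠ y in 𝓝 p, Module.finrank ℝ (LinearMap.range (fderiv ℝ f y).toLinearMap) ≤
      Module.finrank ℝ (LinearMap.range (fderiv ℝ f p).toLinearMap))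
    {u : P} (hu : fderiv ℝ f p u = 0) :
    ∃ x : ℝ → P, AnalyticAt ℝ x 0 ∧ x 0 = p ∧ HasDerivAt x u 0 ∧
      ∀ᶠ t in 𝓝 (0 : ℝ), f (x t) = f p := by
  have : CompleteSpace P := FiniteDimensional.complete ℝ P
  set A := fderiv ℝ f p with hA
  set R := LinearMap.range A.toLinearMap with hR
  set K := LinearMap.ker A.toLinearMap with hK
  obtain ⟨πR, hπR⟩ := Submodule.ClosedComplemented.of_finiteDimensional R
  obtain ⟨πK, hπK⟩ := Submodule.ClosedComplemented.of_finiteDimensional K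
  let g : P → R := fun y => πR (f y)
  -- Adding the projection to the kernel makes the derivative at `p` invertible. The path will be
  -- the preimage of a line in the `K` direction, along which `πR ∘ f` is constant.
  let F₀ : P → R × K := fun y => (g y, πK y)
  have hg : ContDiffAt ℝ ω g p := πR.contDiff.contDiffAt.comp p hf
  have hF₀ : ContDiffAt ℝ ω F₀ p := hg.prodMk πK.contDiff.contDiffAt
  have hfd : HasFDerivAt f A p := (hf.differentiableAt (by simp)).hasFDerivAt
  let T : P →L[ℝ] R × K := (πR.comp A).prod πK
  have hT : HasFDerivAt F₀ T p :=
    (πR.hasFDerivAt.comp p hfd).prodMk πK.hasFDerivAt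
  have hπRA : ∀ h, ((πR (A h) : R) : F) = A h := fun h =>
    congrArg Subtype.val (hπR ⟨A h, LinearMap.mem_range_self A.toLinearMap h⟩)
  have hTinj : Function.Injective T.toLinearMap := by
    rw [← LinearMap.ker_eq_bot, LinearMap.ker_eq_bot']
    intro h hh
    have h1 : πR (A h) = 0 := congrArg Prod.fst hh
    have h2 : πK h = 0 := congrArg Prod.snd hh
    have h3 : A h = 0 := by rw [← hπRA h, h1]; rfl
    have h4 := hπK ⟨h, h3⟩
    rw [h2] at h4
    exact (congrArg Subtype.val h4).symm
  have hdim : Module.finrank ℝ P = Module.finrank ℝ (R × K) := by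
    rw [Module.finrank_prod]
    exact (LinearMap.finrank_range_add_finrank_ker A.toLinearMap).symm
  let e : P ≃L[ℝ] R × K :=
    (LinearMap.linearEquivOfInjective T.toLinearMap hTinj hdim).toContinuousLinearEquiv
  have he : (e : P →L[ℝ] R × K) = T := by
    ext1 h; rfl
  have heF : HasFDerivAt F₀ (e : P →L[ℝ] R × K) p := he ▸ hT
  have hψ : ContDiffAt ℝ ω (hF₀.localInverse heF (by simp)) (F₀ p) :=
    hF₀.to_localInverse heF (by simp)
  set ψ := hF₀.localInverse heF (by simp) with hψdef
  have hstrict : HasStrictFDerivAt F₀ (e : P →L[ℝ] R × K) p :=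
    hF₀.hasStrictFDerivAt' heF (by simp)
  have hψp : ψ (F₀ p) = p := hstrict.localInverse_apply_image
  have hright : ∀ᶠ z in 𝓝 (F₀ p), F₀ (ψ z) = z := hstrict.eventually_right_inverse
  have hψd : HasFDerivAt ψ (e.symm : R × K →L[ℝ] P) (F₀ p) :=
    hstrict.to_localInverse.hasFDerivAt
  let k : K := ⟨u, hu⟩
  let l : ℝ → R × K := fun t => F₀ p + t • ((0 : R), k)
  have hl0 : l 0 = F₀ p := by simp [l]
  have hld : ∀ t, HasDerivAt l ((0 : R), k) t := fun t => by
    simpa [l] using ((hasDerivAt_id t).smul_const ((0 : R), k)).const_add (F₀ p)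
  have hlc : ContDiff ℝ ω l := contDiff_const.add (contDiff_id.smul contDiff_const)
  let x : ℝ → P := fun t => ψ (l t)
  have hxan : ContDiffAt ℝ ω x 0 := by
    refine ContDiffAt.comp (g := ψ) 0 ?_ hlc.contDiffAt
    rw [hl0]; exact hψ
  have hx0 : x 0 = p := by simp only [x, hl0, hψp]
  have hxd : HasDerivAt x u 0 := by
    have h1 : HasDerivAt x ((e.symm : R × K →L[ℝ] P) ((0 : R), k)) 0 := by
      refine HasFDerivAt.comp_hasDerivAt (l := ψ) 0 ?_ (hld 0)
      rw [hl0]; exact hψd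
    have h2 : (e.symm : R × K →L[ℝ] P) ((0 : R), k) = u := by
      change e.symm ((0 : R), k) = u
      rw [ContinuousLinearEquiv.symm_apply_eq]
      change _ = T u
      have h3 : πK u = k := hπK k
      have h4 : πR (A u) = 0 := by rw [hu, map_zero]
      exact Prod.ext h4.symm h3.symm
    rwa [h2] at h1
  refine ⟨x, hxan.analyticAt, hx0, hxd, ?_⟩
  have hxcont : Tendsto x (𝓝 0) (𝓝 p) := by
    have := hxd.continuousAt.tendsto
    rwa [hx0] at this
  have hlcont : Tendsto l (𝓝 0) (𝓝 (F₀ p)) := by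
    have := (hld 0).continuousAt.tendsto
    rwa [hl0] at this
  have hfev : ∀ᶠ y in 𝓝 p, ContDiffAt ℝ ω f y := hf.eventually (by simp)
  have hrank' : ∀ᶠ y in 𝓝 p, (Module.finrank ℝ R : Cardinal) ≤
      ((πR.comp (fderiv ℝ f y)).toLinearMap).rank := by
    have hc : ContinuousAt (fun y => πR.comp (fderiv ℝ f y)) p :=
      continuousAt_const.clm_comp ((hf.fderiv_right (m := 0) (by simp)).continuousAt)
    refine hc.eventually ((isOpen_setOfPred_nat_le_rank (Module.finrank ℝ R)).mem_nhds ?_)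
    have h1 : LinearMap.range (πR.comp A).toLinearMap = ⊤ := by
      rw [LinearMap.range_eq_top]
      rintro ⟨_, h, rfl⟩
      exact ⟨h, Subtype.ext (hπRA h)⟩
    change (Module.finrank ℝ R : Cardinal) ≤ LinearMap.rank _
    rw [LinearMap.rank, h1, ← Module.finrank_eq_rank, finrank_top]
  -- Maximality of the rank enters here: after projection by `πR` the rank is still at least that at
  -- `p`, and before projection it is at most that, so the two kernels coincide.
  have hker : ∀ᶠ y in 𝓝 p, ∀ h, πR (fderiv ℝ f y h) = 0 → fderiv ℝ f y h = 0 := by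
    filter_upwards [hrank, hrank'] with y h1 h2 h hh
    have h3 : LinearMap.ker (fderiv ℝ f y).toLinearMap ≤
        LinearMap.ker (πR.comp (fderiv ℝ f y)).toLinearMap := fun z hz => by
      change πR (fderiv ℝ f y z) = 0
      rw [show fderiv ℝ f y z = 0 from hz, map_zero]
    have h4 := LinearMap.finrank_range_add_finrank_ker (fderiv ℝ f y).toLinearMap
    have h5 := LinearMap.finrank_range_add_finrank_ker (πR.comp (fderiv ℝ f y)).toLinearMap
    rw [LinearMap.rank, ← Module.finrank_eq_rank] at h2
    have h6 : Module.finrank ℝ R ≤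
      Module.finrank ℝ (LinearMap.range (πR.comp (fderiv ℝ f y)).toLinearMap) := by
      exact_mod_cast h2
    have h7 := Submodule.eq_of_le_of_finrank_le h3 (by omega)
    exact h7.symm.le (show h ∈ LinearMap.ker (πR.comp (fderiv ℝ f y)).toLinearMap from hh)
  have hxev : ∀ᶠ t in 𝓝 (0 : ℝ), DifferentiableAt ℝ x t :=
    (hxan.eventually (by simp)).mono fun t ht => ht.differentiableAt (by simp)
  have hgood : ∀ᶠ t in 𝓝 (0 : ℝ), HasDerivAt (fun t => f (x t)) 0 t := by
    filter_upwards [hxev, hxcont.eventually hfev, hxcont.eventually hker,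
      (hlcont.eventually hright).eventually_nhds] with t h1 h2 h3 h4
    have h5 : HasDerivAt (fun t => f (x t)) (fderiv ℝ f (x t) (deriv x t)) t :=
      (h2.differentiableAt (by simp)).hasFDerivAt.comp_hasDerivAt t h1.hasDerivAt
    have h6 : HasDerivAt (fun t => πR (f (x t))) (πR (fderiv ℝ f (x t) (deriv x t))) t :=
      πR.hasFDerivAt.comp_hasDerivAt t h5
    have h7 : (fun t => πR (f (x t))) =ᶠ[𝓝 t] fun _ => g p := by
      filter_upwards [h4] with s hs
      change (F₀ (ψ (l s))).1 = g p
      rw [hs]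
      simp [F₀, l]
    have h8 := h6.unique ((hasDerivAt_const t (g p)).congr_of_eventuallyEq h7)
    rwa [h3 _ h8] at h5
  obtain ⟨ε, hε, hball⟩ := Metric.eventually_nhds_iff_ball.1 hgood
  refine Metric.eventually_nhds_iff_ball.2 ⟨ε, hε, fun t ht => ?_⟩
  have := Metric.isOpen_ball.is_const_of_deriv_eq_zero
    (convex_ball (0 : ℝ) ε).isPreconnected
    (f := fun t => f (x t)) (fun s hs => (hball s hs).differentiableAt.differentiableWithinAt)
    (fun s hs => (hball s hs).deriv) ht (Metric.mem_ball_self hε)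
  simpa [hx0] using this

/-! ### Linear algebra -/

/-- Choose a linear section of `f` over its range, compose with `g`, and extend to `Y`. For
linear-combination maps of two families, the kernel inclusion says that every linear relation of the
first family holds for the second. -/
theorem exists_linearMap_comp_eq {X Y Z : Type*} [AddCommGroup X] [Module ℝ X] [AddCommGroup Y]
    [Module ℝ Y] [AddCommGroup Z] [Module ℝ Z] (f : X →ₗ[ℝ] Y) (g : X →ₗ[ℝ] Z)
    (h : LinearMap.ker f ≤ LinearMap.ker g) : ∃ L : Y →ₗ[ℝ] Z, ∀ x, L (f x) = g x := by
  obtain ⟨s, hs⟩ := LinearMap.exists_rightInverse_of_surjective f.rangeRestrict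
    (LinearMap.range_rangeRestrict f)
  obtain ⟨L, hL⟩ := LinearMap.exists_extend (g ∘ₗ s)
  refine ⟨L, fun x => ?_⟩
  have h1 : L (f x) = g (s (f.rangeRestrict x)) := LinearMap.congr_fun hL (f.rangeRestrict x)
  have h2 : f (s (f.rangeRestrict x)) = f x :=
    congrArg Subtype.val (LinearMap.congr_fun hs (f.rangeRestrict x))
  have h3 : s (f.rangeRestrict x) - x ∈ LinearMap.ker f := by
    rw [LinearMap.mem_ker, map_sub, h2, sub_self]
  have h4 := h h3
  rw [LinearMap.mem_ker, map_sub, sub_eq_zero] at h4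
  rw [h1, h4]

theorem isSkew_euclid_iff {m : ℕ} {A : E m →ₗ[ℝ] E m} :
    IsSkew (euclidForm m) A ↔ ∀ a b, inner ℝ (A a) b = -inner ℝ a (A b) := Iff.rfl

/-- A linear relation-preserving family of velocities, skew on all pairs, is the restriction of
an infinitesimal rotation. -/
theorem exists_skew_apply_eq {V : Type*} [Fintype V] {m : ℕ} (e f : V → E m)
    (hdep : ∀ c : V → ℝ, ∑ i, c i • e i = 0 → ∑ i, c i • f i = 0)
    (hskew : ∀ i j, inner ℝ (e i) (f j) + inner ℝ (f i) (e j) = 0) :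
    ∃ A : E m →ₗ[ℝ] E m, IsSkew (euclidForm m) A ∧ ∀ i, A (e i) = f i := by
  classical
  obtain ⟨L, hL⟩ := exists_linearMap_comp_eq (Fintype.linearCombination ℝ e)
    (Fintype.linearCombination ℝ f) (fun c hc => by
      simp only [LinearMap.mem_ker, Fintype.linearCombination_apply] at hc ⊢
      exact hdep c hc)
  have hLe : ∀ i, L (e i) = f i := fun i => by
    simpa [Fintype.linearCombination_apply_single] using hL (Pi.single i 1)
  set W : Submodule ℝ (E m) := Submodule.span ℝ (Set.range e) with hW
  have hW2 : ∀ w ∈ W, ∀ w' ∈ W, inner ℝ w (L w') + inner ℝ (L w) w' = 0 := by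
    intro w hw w' hw'
    induction hw using Submodule.span_induction with
    | mem w hw =>
      obtain ⟨i, rfl⟩ := hw
      induction hw' using Submodule.span_induction with
      | mem w hw =>
        obtain ⟨j, rfl⟩ := hw
        rw [hLe, hLe]; exact hskew i j
      | zero => simp
      | add a b _ _ ha hb => simp only [map_add, inner_add_right]; linarith
      | smul c a _ ha =>
        simp only [map_smul, inner_smul_right]; rw [← mul_add, ha, mul_zero]
    | zero => simp
    | add a b _ _ ha hb => simp only [map_add, inner_add_left]; linarith
    | smul c a _ ha =>
      simp only [map_smul, real_inner_smul_left]; rw [← mul_add, ha, mul_zero]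
  let P : E m →ₗ[ℝ] E m := W.starProjection.toLinearMap
  have hP : ∀ a, P a ∈ W := fun a => W.starProjection_apply_mem a
  have hPs : ∀ a b, inner ℝ (P a) b = inner ℝ a (P b) := fun a b =>
    W.inner_starProjection_left_eq_right a b
  have hPw : ∀ w ∈ W, P w = w := fun w hw => Submodule.starProjection_eq_self_iff.2 hw
  let C : E m →ₗ[ℝ] E m := L ∘ₗ P
  -- On `W` the map must be `L`. Skewness then forces the block from the orthogonal complement of
  -- `W` to `W`, and the remaining block is set to zero.
  refine ⟨C - C.adjoint ∘ₗ (LinearMap.id - P), fun a b => ?_, fun i => ?_⟩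
  · change inner ℝ (C a - C.adjoint (a - P a)) b = -inner ℝ a (C b - C.adjoint (b - P b))
    rw [inner_sub_left, inner_sub_right, LinearMap.adjoint_inner_left,
      LinearMap.adjoint_inner_right, inner_sub_left, inner_sub_right]
    have h := hW2 (P a) (hP a) (P b) (hP b)
    have h1 : inner ℝ (C a) (P b) = inner ℝ (L (P a)) (P b) := rfl
    have h2 : inner ℝ (P a) (C b) = inner ℝ (P a) (L (P b)) := rfl
    linarith
  · have hei : e i ∈ W := Submodule.subset_span ⟨i, rfl⟩
    change L (P (e i)) - C.adjoint (e i - P (e i)) = f i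
    rw [hPw _ hei, sub_self, map_zero, sub_zero, hLe]

/-- Velocities that are first-order rigid on all pairs and preserve affine relations are trivial. -/
theorem exists_trivial_of_affine_relations {V : Type*} [Fintype V] {m : ℕ} (p u : V → E m)
    (hdep : ∀ c : V → ℝ, ∑ i, c i = 0 → ∑ i, c i • p i = 0 → ∑ i, c i • u i = 0)
    (hu : ∀ i j, inner ℝ (p i - p j) (u i - u j) = 0) :
    ∃ (A : E m →ₗ[ℝ] E m) (t : E m), IsSkew (euclidForm m) A ∧ ∀ i, u i = A (p i) + t := by
  classical
  rcases isEmpty_or_nonempty V with hV | ⟨⟨o⟩⟩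
  · exact ⟨0, 0, fun a b => by simp, fun i => hV.elim i⟩
  obtain ⟨A, hA, hAe⟩ := exists_skew_apply_eq (fun i => p i - p o) (fun i => u i - u o)
    (fun c hc => by
      -- A linear relation among the differences `p i - p o` becomes an affine relation once the
      -- total weight is subtracted at `o`.
      have h := hdep (c - Pi.single o (∑ i, c i)) (by simp)
        (by
          simp only [smul_sub, Finset.sum_sub_distrib, ← Finset.sum_smul] at hc
          simpa [sub_smul, Finset.sum_sub_distrib, Pi.single_apply, ite_smul] using hc)
      simp only [smul_sub, Finset.sum_sub_distrib, ← Finset.sum_smul]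
      simpa [sub_smul, Finset.sum_sub_distrib, Pi.single_apply, ite_smul] using h)
    (fun i j => by
      have h1 := hu i o
      have h2 := hu j o
      have h3 := hu i j
      simp only [inner_sub_left, inner_sub_right] at h1 h2 h3 ⊢
      linarith [real_inner_comm (p i) (u j), real_inner_comm (p i) (u o),
        real_inner_comm (p j) (u i), real_inner_comm (p o) (u i), real_inner_comm (p o) (u o),
        real_inner_comm (p o) (u j), real_inner_comm (p j) (u o), real_inner_comm (p j) (u j),
        real_inner_comm (p i) (u i)])
  refine ⟨A, u o - A (p o), hA, fun i => ?_⟩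
  have := hAe i
  rw [map_sub] at this
  rw [sub_eq_iff_eq_add.1 this]
  abel

/-- A trivial infinitesimal motion that is symmetric is generated by an infinitesimal isometry
that commutes with the symmetry group. -/
theorem exists_invariant_generator {V : Type*} [Fintype V] {G : SimpleGraph V} {m : ℕ}
    {S : Subgroup (E m ≃ₗᵢ[ℝ] E m)} {Φ : S →* (G ≃g G)} {p u : V → E m}
    (hp : IsSymmetric Φ p) (hu : IsSymmetric Φ u) {A₀ : E m →ₗ[ℝ] E m} {t₀ : E m}
    (hA₀ : IsSkew (euclidForm m) A₀) (h : ∀ i, u i = A₀ (p i) + t₀) :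
    ∃ (A : E m →ₗ[ℝ] E m) (t : E m), IsSkew (euclidForm m) A ∧ (∀ i, u i = A (p i) + t) ∧
      (∀ (x : S) (a : E m), (x : E m ≃ₗᵢ[ℝ] E m) (A a) = A ((x : E m ≃ₗᵢ[ℝ] E m) a)) ∧
      ∀ x : S, (x : E m ≃ₗᵢ[ℝ] E m) t = t := by
  -- The type permutes the vertices, so the centroid of a symmetric family is fixed by `S`. Centring
  -- there replaces averaging over `S`, which may be infinite.
  let cen : (V → E m) → E m := fun w => (Fintype.card V : ℝ)⁻¹ • ∑ i, w i
  have hcen : ∀ w, IsSymmetric Φ w → ∀ x : S, (x : E m ≃ₗᵢ[ℝ] E m) (cen w) = cen w := by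
    intro w hw x
    simp only [cen, map_smul, map_sum, hw x]
    rw [← Equiv.sum_comp (Φ x).toEquiv w]
    rfl
  let e : V → E m := fun i => p i - cen p
  have he : ∀ (x : S) i, (x : E m ≃ₗᵢ[ℝ] E m) (e i) = e (Φ x i) := fun x i => by
    simp only [e, map_sub, hcen p hp, hp x]
  have hf : ∀ i, A₀ (e i) = u i - cen u := by
    intro i
    have hn : (Fintype.card V : ℝ) ≠ 0 := by
      have : Nonempty V := ⟨i⟩
      exact_mod_cast Fintype.card_ne_zero
    have h1 : cen u = A₀ (cen p) + t₀ := by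
      simp only [cen, h, Finset.sum_add_distrib, map_smul, map_sum, smul_add, Finset.sum_const,
        Finset.card_univ]
      rw [← Nat.cast_smul_eq_nsmul ℝ, smul_smul, inv_mul_cancel₀ hn, one_smul]
    rw [h1, h i, map_sub]
    abel
  have hfsym : ∀ (x : S) i, (x : E m ≃ₗᵢ[ℝ] E m) (A₀ (e i)) = A₀ (e (Φ x i)) := fun x i => by
    rw [hf, hf, map_sub, hcen u hu, hu x]
  set W : Submodule ℝ (E m) := Submodule.span ℝ (Set.range e) with hW
  let P : E m →ₗ[ℝ] E m := W.starProjection.toLinearMap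
  have hP : ∀ a, P a ∈ W := fun a => W.starProjection_apply_mem a
  have hPs : ∀ a b, inner ℝ (P a) b = inner ℝ a (P b) := fun a b =>
    W.inner_starProjection_left_eq_right a b
  have hPw : ∀ w ∈ W, P w = w := fun w hw => Submodule.starProjection_eq_self_iff.2 hw
  have hWx : ∀ x : S, W.map ((x : E m ≃ₗᵢ[ℝ] E m).toLinearEquiv : E m →ₗ[ℝ] E m) = W := by
    intro x
    rw [hW, Submodule.map_span, ← Set.range_comp]
    congr 1
    ext a
    constructor
    · rintro ⟨i, rfl⟩
      exact ⟨Φ x i, (he x i).symm⟩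
    · rintro ⟨i, rfl⟩
      refine ⟨(Φ x).symm i, ?_⟩
      change (x : E m ≃ₗᵢ[ℝ] E m) (e _) = _
      rw [he]
      simp
  have hPx : ∀ (x : S) a, P ((x : E m ≃ₗᵢ[ℝ] E m) a) = (x : E m ≃ₗᵢ[ℝ] E m) (P a) := by
    intro x a
    have h1 := Submodule.starProjection_map_apply (x : E m ≃ₗᵢ[ℝ] E m) W
      ((x : E m ≃ₗᵢ[ℝ] E m) a)
    rw [LinearIsometryEquiv.symm_apply_apply] at h1
    have h2 := congrArg (fun U : Submodule ℝ (E m) =>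
      U.starProjection ((x : E m ≃ₗᵢ[ℝ] E m) a)) (hWx x)
    exact h2.symm.trans h1
  have hAW : ∀ (x : S), ∀ w ∈ W, (x : E m ≃ₗᵢ[ℝ] E m) (A₀ w) = A₀ ((x : E m ≃ₗᵢ[ℝ] E m) w) := by
    intro x w hw
    induction hw using Submodule.span_induction with
    | mem w hw =>
      obtain ⟨i, rfl⟩ := hw
      rw [hfsym, he]
    | zero => simp
    | add a b _ _ ha hb => simp only [map_add, ha, hb]
    | smul c a _ ha => simp only [map_smul, ha]
  have hAP : ∀ (x : S) a, (x : E m ≃ₗᵢ[ℝ] E m) (A₀ (P a)) =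
      A₀ (P ((x : E m ≃ₗᵢ[ℝ] E m) a)) := fun x a => by
    rw [hPx, hAW x _ (hP a)]
  -- By skewness, `P ∘ A₀` is minus the adjoint of `A₀ ∘ P`, so commutation passes from one to the
  -- other.
  have hPA : ∀ (x : S) a, (x : E m ≃ₗᵢ[ℝ] E m) (P (A₀ a)) =
      P (A₀ ((x : E m ≃ₗᵢ[ℝ] E m) a)) := by
    intro x a
    refine ext_inner_right ℝ fun b => ?_
    obtain ⟨b, rfl⟩ := (x : E m ≃ₗᵢ[ℝ] E m).surjective b
    rw [LinearIsometryEquiv.inner_map_map, hPs, hPs, isSkew_euclid_iff.1 hA₀,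
      isSkew_euclid_iff.1 hA₀, ← hAP, LinearIsometryEquiv.inner_map_map]
  -- This is `A₀` with its block on the orthogonal complement of `W` removed. That block is not seen
  -- by the joints and is the only one that may fail to commute with `S`.
  let A : E m →ₗ[ℝ] E m := P ∘ₗ A₀ + A₀ ∘ₗ P - P ∘ₗ A₀ ∘ₗ P
  have hAdef : ∀ a, A a = P (A₀ a) + A₀ (P a) - P (A₀ (P a)) := fun a => rfl
  have hAx : ∀ (x : S) a, (x : E m ≃ₗᵢ[ℝ] E m) (A a) = A ((x : E m ≃ₗᵢ[ℝ] E m) a) := by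
    intro x a
    rw [hAdef, hAdef, map_sub, map_add, hPA, hAP, hPA, hPx]
  refine ⟨A, cen u - A (cen p), fun a b => ?_, fun i => ?_, hAx, fun x => ?_⟩
  · change inner ℝ (A a) b = -inner ℝ a (A b)
    have hs := isSkew_euclid_iff.1 hA₀
    rw [hAdef, hAdef, inner_sub_left, inner_add_left, inner_sub_right, inner_add_right, hPs, hs,
      hs, hPs, hPs, hs, hPs]
    ring
  · have hei : e i ∈ W := Submodule.subset_span ⟨i, rfl⟩
    have h1 : A (e i) = u i - cen u := by
      rw [hAdef, hPw _ hei, hf]; abel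
    have h2 : A (p i) - A (cen p) = u i - cen u := by rw [← map_sub]; exact h1
    rw [sub_eq_iff_eq_add.1 h2]
    abel
  · rw [map_sub, hAx, hcen u hu, hcen p hp]

/-! ### The projective model of the space of curvature `σ` -/

/-- The last coordinate of the point over `a` on the quadric `|a|² + σ a_{d+1}² = σ`. -/
def height {m : ℕ} (σ : ℝ) (a : E m) : ℝ := (√(1 + σ * ‖a‖ ^ 2))⁻¹

/-- The squared distance of the points over `a` and `b` on the quadric of curvature `σ`. -/
def liftSqDist {m : ℕ} (σ : ℝ) (a b : E m) : ℝ :=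
  ‖height σ a • a - height σ b • b‖ ^ 2 + σ * (height σ a - height σ b) ^ 2

/-- The Euclidean velocity that corresponds to the velocity `h` at `a` in the projective model. -/
def euclidVel {m : ℕ} (σ : ℝ) (a h : E m) : E m :=
  h - (σ * height σ a ^ 2 * inner ℝ a h) • a

/-- The inverse of `euclidVel σ a`. -/
def modelVel {m : ℕ} (σ : ℝ) (a u : E m) : E m := u + (σ * inner ℝ a u) • a

section Model

variable {m : ℕ} {σ : ℝ} {a b : E m}

theorem height_pos (ha : 0 < 1 + σ * ‖a‖ ^ 2) : 0 < height σ a :=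
  inv_pos.2 (Real.sqrt_pos.2 ha)

theorem height_sq_mul (ha : 0 < 1 + σ * ‖a‖ ^ 2) : height σ a ^ 2 * (1 + σ * ‖a‖ ^ 2) = 1 := by
  rw [height, inv_pow, Real.sq_sqrt ha.le, inv_mul_cancel₀ ha.ne']

@[simp] theorem height_zero (a : E m) : height 0 a = 1 := by simp [height]

theorem liftSqDist_zero (a b : E m) : liftSqDist 0 a b = ‖a - b‖ ^ 2 := by simp [liftSqDist]

@[simp] theorem euclidVel_zero (a h : E m) : euclidVel 0 a h = h := by simp [euclidVel]

theorem liftSqDist_comm (a b : E m) : liftSqDist σ a b = liftSqDist σ b a := by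
  rw [liftSqDist, liftSqDist, norm_sub_rev]; ring

theorem euclidVel_modelVel (ha : 0 < 1 + σ * ‖a‖ ^ 2) (u : E m) :
    euclidVel σ a (modelVel σ a u) = u := by
  have h := height_sq_mul ha
  rw [euclidVel, modelVel, add_sub_assoc, ← sub_smul, inner_add_right, inner_smul_right,
    real_inner_self_eq_norm_sq]
  have : σ * inner ℝ a u - σ * height σ a ^ 2 * (inner ℝ a u + σ * inner ℝ a u * ‖a‖ ^ 2) = 0 := by
    linear_combination (-σ * inner ℝ a u) * h
  rw [this, zero_smul, add_zero]

theorem modelVel_euclidVel (ha : 0 < 1 + σ * ‖a‖ ^ 2) (u : E m) :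
    modelVel σ a (euclidVel σ a u) = u := by
  have h := height_sq_mul ha
  rw [euclidVel, modelVel, sub_add, ← sub_smul, inner_sub_right, inner_smul_right,
    real_inner_self_eq_norm_sq]
  have : σ * height σ a ^ 2 * inner ℝ a u -
      σ * (inner ℝ a u - σ * height σ a ^ 2 * inner ℝ a u * ‖a‖ ^ 2) = 0 := by
    linear_combination (σ * inner ℝ a u) * h
  rw [this, zero_smul, sub_zero]

theorem hasDerivAt_height {x : ℝ → E m} {x' : E m} {t : ℝ} (hx : HasDerivAt x x' t)
    (h : 0 < 1 + σ * ‖x t‖ ^ 2) :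
    HasDerivAt (fun s => height σ (x s)) (-(σ * inner ℝ (x t) x') * height σ (x t) ^ 3) t := by
  have h1 : HasDerivAt (fun s => 1 + σ * ‖x s‖ ^ 2) (σ * (2 * inner ℝ (x t) x')) t :=
    (hx.norm_sq.const_mul σ).const_add 1
  have h2 := (h1.sqrt h.ne').inv (Real.sqrt_pos.2 h).ne'
  refine h2.congr_deriv ?_
  have h3 : √(1 + σ * ‖x t‖ ^ 2) ≠ 0 := (Real.sqrt_pos.2 h).ne'
  unfold height
  field_simp

/-- The point `height σ x • x` has velocity `height σ x • euclidVel σ x x'`. Since the factor in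
front of the inner product is positive, first-order preservation of a length does not depend on the
curvature. -/
theorem hasDerivAt_liftSqDist (hσ : σ = 0 ∨ σ ^ 2 = 1) {x y : ℝ → E m} {x' y' : E m} {t : ℝ}
    (hx : HasDerivAt x x' t) (hy : HasDerivAt y y' t) (hx0 : 0 < 1 + σ * ‖x t‖ ^ 2) (hy0 : 0 < 1 + σ * ‖y t‖ ^ 2) :
    HasDerivAt (fun s => liftSqDist σ (x s) (y s))
      (2 * height σ (x t) * height σ (y t) *
        inner ℝ (x t - y t) (euclidVel σ (x t) x' - euclidVel σ (y t) y')) t := by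
  rcases hσ with rfl | hσ
  · simp only [liftSqDist_zero, height_zero, euclidVel_zero, mul_one]
    exact (hx.sub hy).norm_sq
  have hα := hasDerivAt_height hx hx0
  have hβ := hasDerivAt_height hy hy0
  have h1 := ((hα.smul hx).sub (hβ.smul hy)).norm_sq.add (((hα.sub hβ).pow 2).const_mul σ)
  refine h1.congr_deriv ?_
  have e1 := height_sq_mul hx0
  have e2 := height_sq_mul hy0
  simp only [euclidVel, Pi.sub_apply, inner_sub_left, inner_sub_right, inner_add_right,
    inner_smul_right, real_inner_smul_left, real_inner_self_eq_norm_sq, Nat.cast_ofNat,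
    Pi.smul_apply', real_inner_comm (x t) (y t), Nat.add_one_sub_one, pow_one]
  -- The claim is now polynomial: `e1` and `e2` eliminate the norms, and `hσ` eliminates the squares
  -- of `σ`.
  generalize height σ (x t) = α at *
  generalize height σ (y t) = β at *
  generalize ‖x t‖ ^ 2 = a at *
  generalize ‖y t‖ ^ 2 = b at *
  generalize inner ℝ (x t) x' = c₁
  generalize inner ℝ (y t) y' = c₂
  generalize inner ℝ (x t) y' = c₃
  generalize inner ℝ (y t) x' = c₄
  generalize inner ℝ (y t) (x t) = c₅
  linear_combination (-2 * α ^ 2 * c₁ + 2 * α * β * c₁) * e1 +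
    (-2 * β ^ 2 * c₂ + 2 * α * β * c₂) * e2 +
    (2 * α ^ 3 * β * c₁ + 2 * α * β ^ 3 * c₂ - 2 * α ^ 4 * c₁ - 2 * β ^ 4 * c₂) * hσ

end Model

/-! ### Edge functions of the projective model and their derivatives -/

/-- The squared lengths of all bars of a configuration in the projective model. -/
def modelEdgeFunction {V : Type*} {m : ℕ} (σ : ℝ) (G : SimpleGraph V) (y : V → E m) :
    G.edgeSet → ℝ :=
  fun e => Sym2.lift ⟨fun i j => liftSqDist σ (y i) (y j), fun _ _ => liftSqDist_comm _ _⟩ e.1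

section ModelFrameworks

variable {V : Type*} {G : SimpleGraph V} {m : ℕ} {σ : ℝ}
  {S : Subgroup (E m ≃ₗᵢ[ℝ] E m)} {Φ : S →* (G ≃g G)}

theorem modelEdgeFunction_mk (G : SimpleGraph V) (y : V → E m) {i j : V} (h : s(i, j) ∈ G.edgeSet) :
    modelEdgeFunction σ G y ⟨s(i, j), h⟩ = liftSqDist σ (y i) (y j) := rfl

theorem modelEdgeFunction_eq_iff {y z : V → E m} :
    modelEdgeFunction σ G y = modelEdgeFunction σ G z ↔
      ∀ i j, G.Adj i j → liftSqDist σ (y i) (y j) = liftSqDist σ (z i) (z j) := by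
  constructor
  · intro h i j hij
    exact congrFun h ⟨s(i, j), hij⟩
  · intro h
    funext ⟨e, he⟩
    induction e using Sym2.ind with
    | _ i j => exact h i j he

theorem edgeFunction_mk (B : E m →ₗ[ℝ] E m →ₗ[ℝ] ℝ) (G : SimpleGraph V) (y : V → E m) {i j : V}
    (h : s(i, j) ∈ G.edgeSet) :
    edgeFunction B G y ⟨s(i, j), h⟩ = B (y i - y j) (y i - y j) := rfl

theorem edgeFunction_eq_iff {B : E m →ₗ[ℝ] E m →ₗ[ℝ] ℝ} {y z : V → E m} :
    edgeFunction B G y = edgeFunction B G z ↔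
      ∀ i j, G.Adj i j → B (y i - y j) (y i - y j) = B (z i - z j) (z i - z j) := by
  constructor
  · intro h i j hij
    exact congrFun h ⟨s(i, j), hij⟩
  · intro h
    funext ⟨e, he⟩
    induction e using Sym2.ind with
    | _ i j => exact h i j he

theorem modelEdgeFunction_zero (G : SimpleGraph V) (y : V → E m) :
    modelEdgeFunction 0 G y = edgeFunction (euclidForm m) G y := by
  funext ⟨e, he⟩
  induction e using Sym2.ind with
  | _ i j =>
    rw [modelEdgeFunction_mk, edgeFunction_mk, liftSqDist_zero, ← real_inner_self_eq_norm_sq]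
    rfl

theorem height_eq_of_norm_eq {m : ℕ} {a b : E m} (h : ‖a‖ = ‖b‖) : height σ a = height σ b := by
  rw [height, height, h]

theorem IsSymmetric.norm_eq {y : V → E m} (hy : IsSymmetric Φ y) (x : S) (i : V) :
    ‖y (Φ x i)‖ = ‖y i‖ := by
  rw [← hy x i, LinearIsometryEquiv.norm_map]

theorem IsSymmetric.height_eq {y : V → E m} (hy : IsSymmetric Φ y) (x : S) (i : V) :
    height σ (y (Φ x i)) = height σ (y i) :=
  height_eq_of_norm_eq (hy.norm_eq x i)

theorem IsSymmetric.inner_eq {y h : V → E m} (hy : IsSymmetric Φ y) (hh : IsSymmetric Φ h) (x : S)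
    (i : V) : inner ℝ (y (Φ x i)) (h (Φ x i)) = inner ℝ (y i) (h i) := by
  rw [← hy x i, ← hh x i, LinearIsometryEquiv.inner_map_map]

theorem IsSymmetric.euclidVel {y h : V → E m} (hy : IsSymmetric Φ y) (hh : IsSymmetric Φ h) :
    IsSymmetric Φ fun i => euclidVel σ (y i) (h i) := fun x i => by
  simp only [SymFramework.euclidVel, map_sub, map_smul, hy.height_eq, hy.inner_eq hh, hy x i,
    hh x i]

theorem IsSymmetric.modelVel {y h : V → E m} (hy : IsSymmetric Φ y) (hh : IsSymmetric Φ h) :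
    IsSymmetric Φ fun i => modelVel σ (y i) (h i) := fun x i => by
  simp only [SymFramework.modelVel, map_add, map_smul, hy.inner_eq hh, hy x i, hh x i]

/-- The linear correspondence between symmetric velocities in the projective model of curvature
`σ` and symmetric Euclidean velocities. -/
def velEquiv (σ : ℝ) (y : symConfigs Φ) (hy : ∀ i, 0 < 1 + σ * ‖y.1 i‖ ^ 2) :
    symConfigs Φ ≃ₗ[ℝ] symConfigs Φ where
  toFun h := ⟨fun i => euclidVel σ (y.1 i) (h.1 i), IsSymmetric.euclidVel y.2 h.2⟩
  invFun h := ⟨fun i => modelVel σ (y.1 i) (h.1 i), IsSymmetric.modelVel y.2 h.2⟩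
  left_inv h := Subtype.ext (funext fun i => modelVel_euclidVel (hy i) _)
  right_inv h := Subtype.ext (funext fun i => euclidVel_modelVel (hy i) _)
  map_add' h k := Subtype.ext (funext fun i => by
    simp only [euclidVel, Submodule.coe_add, Pi.add_apply, inner_add_right, mul_add, add_smul]
    abel)
  map_smul' c h := Subtype.ext (funext fun i => by
    simp only [euclidVel, Submodule.coe_smul, Pi.smul_apply, inner_smul_right, RingHom.id_apply,
      smul_sub, smul_smul]
    ring_nf)

theorem isInfMotion_euclid_iff {y u : V → E m} : IsInfMotion (euclidForm m) G y u ↔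
    ∀ i j, G.Adj i j → inner ℝ (y i - y j) (u i - u j) = 0 := Iff.rfl

theorem contDiffAt_height {a : E m} (ha : 0 < 1 + σ * ‖a‖ ^ 2) : ContDiffAt ℝ ω (height σ) a := by
  have h1 : ContDiffAt ℝ ω (fun a : E m => 1 + σ * ‖a‖ ^ 2) a :=
    (contDiff_const.add (contDiff_const.mul (contDiff_norm_sq ℝ))).contDiffAt
  exact (h1.sqrt ha.ne').inv (Real.sqrt_pos.2 ha).ne'

theorem contDiffAt_modelEdgeFunction [Fintype V] (G' : SimpleGraph V) [Fintype G'.edgeSet]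
    {y : symConfigs Φ} (hy : ∀ i, 0 < 1 + σ * ‖y.1 i‖ ^ 2) :
    ContDiffAt ℝ ω (fun y : symConfigs Φ => modelEdgeFunction σ G' (y : V → E m)) y := by
  classical
  rw [contDiffAt_pi]
  rintro ⟨e, he⟩
  induction e using Sym2.ind with
  | _ i j =>
    simp only [modelEdgeFunction_mk]
    have hc : ∀ i, ContDiffAt ℝ ω (fun y : symConfigs Φ => y.1 i) y := fun i =>
      ((ContinuousLinearMap.proj i).comp (symConfigs Φ).subtypeL).contDiff.contDiffAt
    have hh : ∀ i, ContDiffAt ℝ ω (fun y : symConfigs Φ => height σ (y.1 i)) y := fun i =>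
      ContDiffAt.comp (g := height σ) y (contDiffAt_height (hy i)) (hc i)
    exact (ContDiffAt.norm_sq ℝ (((hh i).smul (hc i)).sub ((hh j).smul (hc j)))).add
      (contDiffAt_const.mul (((hh i).sub (hh j)).pow 2))

theorem hasDerivAt_modelEdgeFunction_iff (hσ : σ = 0 ∨ σ ^ 2 = 1) (G' : SimpleGraph V)
    {x : ℝ → V → E m} {x' : V → E m} {t : ℝ} (hx : ∀ i, HasDerivAt (fun t => x t i) (x' i) t)
    (h : ∀ i, 0 < 1 + σ * ‖x t i‖ ^ 2) :
    HasDerivAt (fun t => modelEdgeFunction σ G' (x t)) 0 t ↔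
      IsInfMotion (euclidForm m) G' (x t) fun i => euclidVel σ (x t i) (x' i) := by
  classical
  rw [hasDerivAt_pi, isInfMotion_euclid_iff]
  have key : ∀ i j, (HasDerivAt (fun s => liftSqDist σ (x s i) (x s j)) 0 t ↔
      inner ℝ (x t i - x t j)
        (euclidVel σ (x t i) (x' i) - euclidVel σ (x t j) (x' j)) = 0) := fun i j => by
    have h1 := hasDerivAt_liftSqDist hσ (hx i) (hx j) (h i) (h j)
    have h2 : 2 * height σ (x t i) * height σ (x t j) ≠ 0 :=
      (mul_pos (mul_pos two_pos (height_pos (h i))) (height_pos (h j))).ne'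
    constructor
    · intro h3
      exact (mul_eq_zero.1 (h1.unique h3)).resolve_left h2
    · intro h3
      rwa [h3, mul_zero] at h1
  constructor
  · intro H i j hij
    exact (key i j).1 (H ⟨s(i, j), hij⟩)
  · rintro H ⟨e, he⟩
    induction e using Sym2.ind with
    | _ i j => exact (key i j).2 (H i j he)

/-- Differentiate along the line `y + t • h`. The graph `G'` is independent of the graph carrying
the symmetry, so that the complete graph is covered too. -/
theorem fderiv_modelEdgeFunction_eq_zero_iff [Fintype V] (hσ : σ = 0 ∨ σ ^ 2 = 1)
    (G' : SimpleGraph V) {y : symConfigs Φ} (hy : ∀ i, 0 < 1 + σ * ‖y.1 i‖ ^ 2) (h : symConfigs Φ) :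
    fderiv ℝ (fun y : symConfigs Φ => modelEdgeFunction σ G' (y : V → E m)) y h = 0 ↔
      IsInfMotion (euclidForm m) G' y.1 fun i => euclidVel σ (y.1 i) (h.1 i) := by
  classical
  have hl : HasDerivAt (fun t : ℝ => y + t • h) h 0 := by
    simpa using ((hasDerivAt_id (0 : ℝ)).smul_const h).const_add y
  have h1 : HasDerivAt (fun t : ℝ => modelEdgeFunction σ G' ((y + t • h : symConfigs Φ) : V → E m))
      (fderiv ℝ (fun y : symConfigs Φ => modelEdgeFunction σ G' (y : V → E m)) y h) 0 := by
    refine HasFDerivAt.comp_hasDerivAt (l := fun y : symConfigs Φ => modelEdgeFunction σ G' y.1)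
      0 ?_ hl
    simp only [zero_smul, add_zero]
    exact ((contDiffAt_modelEdgeFunction G' hy).differentiableAt (by simp)).hasFDerivAt
  have h2 := hasDerivAt_modelEdgeFunction_iff (σ := σ) hσ G' (t := 0)
    (x := fun t : ℝ => ((y + t • h : symConfigs Φ) : V → E m)) (x' := h.1)
    (fun i => ((ContinuousLinearMap.proj i).comp
      (symConfigs Φ).subtypeL).hasFDerivAt.comp_hasDerivAt 0 hl)
    (by simpa using hy)
  simp only [zero_smul, add_zero] at h2
  rw [← h2]
  constructor
  · intro h3; rwa [h3] at h1
  · intro h3; exact h1.unique h3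

/-- `velEquiv` maps the kernel for curvature `σ` onto the kernel for curvature 0, and rank-nullity
concludes. This lets a Euclidean regularity hypothesis serve all three geometries. -/
theorem finrank_range_fderiv_modelEdgeFunction [Fintype V] (hσ : σ = 0 ∨ σ ^ 2 = 1)
    (y : symConfigs Φ) (hy : ∀ i, 0 < 1 + σ * ‖y.1 i‖ ^ 2) :
    Module.finrank ℝ (LinearMap.range (fderiv ℝ
      (fun y : symConfigs Φ => modelEdgeFunction σ G (y : V → E m)) y).toLinearMap) =
      symRank Φ y := by
  have h0 : (fun y : symConfigs Φ => edgeFunction (euclidForm m) G (y : V → E m)) =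
      fun y : symConfigs Φ => modelEdgeFunction 0 G (y : V → E m) :=
    funext fun y => (modelEdgeFunction_zero G _).symm
  rw [symRank, h0]
  set D := fderiv ℝ (fun y : symConfigs Φ => modelEdgeFunction σ G (y : V → E m)) y
  set D₀ := fderiv ℝ (fun y : symConfigs Φ => modelEdgeFunction 0 G (y : V → E m)) y
  have hker : LinearMap.ker D.toLinearMap =
      (LinearMap.ker D₀.toLinearMap).comap (velEquiv σ y hy : symConfigs Φ →ₗ[ℝ] symConfigs Φ) := by
    ext h
    refine (fderiv_modelEdgeFunction_eq_zero_iff hσ G hy h).trans ?_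
    refine Iff.trans ?_ (fderiv_modelEdgeFunction_eq_zero_iff (Or.inl rfl) G (by simp) _).symm
    simp only [euclidVel_zero]
    rfl
  have h1 := LinearMap.finrank_range_add_finrank_ker D.toLinearMap
  have h2 := LinearMap.finrank_range_add_finrank_ker D₀.toLinearMap
  have h3 : Module.finrank ℝ (LinearMap.ker D.toLinearMap) =
      Module.finrank ℝ (LinearMap.ker D₀.toLinearMap) := by
    rw [hker]
    exact ((velEquiv σ y hy).submoduleMap _ |>.finrank_eq).trans
      (by rw [Submodule.map_comap_eq_of_surjective (velEquiv σ y hy).surjective])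
  omega

end ModelFrameworks

/-! ### From infinitesimal to finite flexes -/

section ModelFlexes

variable {V : Type*} {G : SimpleGraph V} {m : ℕ} {σ : ℝ}
  {S : Subgroup (E m ≃ₗᵢ[ℝ] E m)} {Φ : S →* (G ≃g G)}

/-- On the quadric each lifted point has self-product `σ`, so polarization applies: mutual distances
determine the Gram matrix of the lifted points. -/
theorem liftSqDist_eq_sub (hσ : σ ^ 2 = 1) {a b : E m} (ha : 0 < 1 + σ * ‖a‖ ^ 2)
    (hb : 0 < 1 + σ * ‖b‖ ^ 2) :
    liftSqDist σ a b = 2 * σ - 2 * (height σ a * height σ b * (inner ℝ a b + σ)) := by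
  rw [liftSqDist, norm_sub_sq_real, norm_smul, norm_smul, real_inner_smul_left, inner_smul_right,
    mul_pow, mul_pow, Real.norm_eq_abs, Real.norm_eq_abs, sq_abs, sq_abs]
  linear_combination σ * height_sq_mul ha + σ * height_sq_mul hb -
    (height σ a ^ 2 * ‖a‖ ^ 2 + height σ b ^ 2 * ‖b‖ ^ 2) * hσ

/-- Linear relations among the lifted points are determined by the mutual distances. -/
theorem sum_height_smul_eq_zero [Fintype V] (hσ : σ = 0 ∨ σ = 1 ∨ σ = -1) {y z : V → E m}
    (hy : ∀ i, 0 < 1 + σ * ‖y i‖ ^ 2) (hz : ∀ i, 0 < 1 + σ * ‖z i‖ ^ 2)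
    (hyz : ∀ i j, liftSqDist σ (y i) (y j) = liftSqDist σ (z i) (z j)) {b : V → ℝ}
    (hb : ∑ i, b i * height σ (z i) = 0) (hbz : ∑ i, (b i * height σ (z i)) • z i = 0) :
    ∑ i, (b i * height σ (y i)) • y i = 0 := by
  rcases hσ with rfl | hσ
  · simp only [height_zero, mul_one, liftSqDist_zero] at *
    -- With weights of sum zero, the squared norm of the combination is a function of the squared
    -- distances alone.
    rw [← inner_self_eq_zero (𝕜 := ℝ),
      inner_sum_smul_sum_smul_of_sum_eq_zero y hb y hb]
    simp only [← sq, hyz]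
    simp only [sq]
    rw [← inner_sum_smul_sum_smul_of_sum_eq_zero z hb z hb, hbz,
      inner_zero_left]
  have hσ2 : σ ^ 2 = 1 := by rcases hσ with rfl | rfl <;> norm_num
  set s := ∑ i, (b i * height σ (y i)) • y i with hs
  set c := ∑ i, b i * height σ (y i) with hc
  have hgram : ∀ i j, height σ (y i) * height σ (y j) * (inner ℝ (y i) (y j) + σ) =
      height σ (z i) * height σ (z j) * (inner ℝ (z i) (z j) + σ) := fun i j => by
    have := hyz i j
    rw [liftSqDist_eq_sub hσ2 (hy i) (hy j), liftSqDist_eq_sub hσ2 (hz i) (hz j)] at this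
    linarith
  have expand : ∀ (w : V → E m) j, height σ (w j) * (inner ℝ (∑ i, (b i * height σ (w i)) • w i)
      (w j) + σ * ∑ i, b i * height σ (w i)) =
      ∑ i, b i * (height σ (w i) * height σ (w j) * (inner ℝ (w i) (w j) + σ)) := by
    intro w j
    simp only [sum_inner, real_inner_smul_left, Finset.mul_sum, ← Finset.sum_add_distrib]
    exact Finset.sum_congr rfl fun i _ => by ring
  -- The vector `(s, c)` is the combination of the points lifted from `y`. Equal Gram matrices make
  -- it orthogonal, for the form, to every lifted point, and therefore (`hss`) to itself.
  have hsy : ∀ j, inner ℝ s (y j) = -(σ * c) := by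
    intro j
    have h1 := expand y j
    simp only [hgram] at h1
    rw [← expand z j, hb, hbz, inner_zero_left, mul_zero, add_zero, mul_zero] at h1
    have h2 := (mul_eq_zero.1 h1).resolve_left (height_pos (hy j)).ne'
    linarith
  have hss : ‖s‖ ^ 2 = -(σ * c ^ 2) := by
    have h1 : inner ℝ s s = ∑ i, (b i * height σ (y i)) * inner ℝ s (y i) := by
      conv_lhs => rw [hs]
      rw [inner_sum]
      simp only [inner_smul_right]
      rfl
    rw [← real_inner_self_eq_norm_sq, h1]
    simp only [hsy, ← Finset.sum_mul]
    rw [← hc]; ring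
  rcases hσ with rfl | rfl
  · have : ‖s‖ ^ 2 ≤ 0 := by rw [hss]; nlinarith [sq_nonneg c]
    exact norm_eq_zero.1 (pow_eq_zero_iff two_ne_zero |>.1 (le_antisymm this (sq_nonneg _)))
  -- In the Minkowski case an isotropic vector orthogonal to a timelike one vanishes: Cauchy-Schwarz
  -- gives `‖s‖ ≤ ‖s‖ * ‖y j‖`, and `‖y j‖ < 1`.
  · rcases isEmpty_or_nonempty V with hV | ⟨⟨j⟩⟩
    · rw [hs, Finset.univ_eq_empty, Finset.sum_empty]
    have h1 := hsy j
    have h2 := hy j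
    have h3 := abs_real_inner_le_norm s (y j)
    rw [h1] at h3
    have h4 : (‖s‖) ^ 2 ≤ (‖s‖ * ‖y j‖) ^ 2 := by
      rw [← sq_abs c] at hss
      simp only [neg_mul, one_mul, neg_neg] at h3 hss
      rw [hss]
      exact pow_le_pow_left₀ (abs_nonneg _) h3 2
    have h5 : ‖s‖ ^ 2 * (1 + -1 * ‖y j‖ ^ 2) ≤ 0 := by rw [mul_pow] at h4; linarith
    have h6 : ‖s‖ ^ 2 ≤ 0 := nonpos_of_mul_nonpos_left h5 h2
    exact norm_eq_zero.1 (pow_eq_zero_iff two_ne_zero |>.1 (le_antisymm h6 (sq_nonneg _)))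

/-- The initial velocity of a path of congruent configurations is trivial. -/
theorem exists_trivial_of_congruent_path [Fintype V] (hσ : σ = 0 ∨ σ = 1 ∨ σ = -1)
    {x : ℝ → V → E m} {x' : V → E m} (hx : ∀ i, HasDerivAt (fun t => x t i) (x' i) 0)
    (h0 : ∀ i, 0 < 1 + σ * ‖x 0 i‖ ^ 2)
    (hpos : ∀ᶠ t in 𝓝 (0 : ℝ), ∀ i, 0 < 1 + σ * ‖x t i‖ ^ 2)
    (hcong : ∀ᶠ t in 𝓝 (0 : ℝ), modelEdgeFunction σ ⊤ (x t) = modelEdgeFunction σ ⊤ (x 0)) :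
    ∃ (A : E m →ₗ[ℝ] E m) (t : E m), IsSkew (euclidForm m) A ∧
      ∀ i, euclidVel σ (x 0 i) (x' i) = A (x 0 i) + t := by
  classical
  have hσ' : σ = 0 ∨ σ ^ 2 = 1 := by rcases hσ with rfl | rfl | rfl <;> norm_num
  refine exists_trivial_of_affine_relations (x 0) (fun i => euclidVel σ (x 0 i) (x' i))
    (fun c hc hcx => ?_) (fun i j => ?_)
  -- Dividing by the initial heights turns an affine relation of `x 0` into a linear relation of the
  -- lifted points. Congruence keeps it along the path, and its derivative is the required relation
  -- between velocities.
  · let b : V → ℝ := fun i => c i / height σ (x 0 i)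
    have hb : ∀ i, b i * height σ (x 0 i) = c i := fun i =>
      div_mul_cancel₀ _ (height_pos (h0 i)).ne'
    have hzero : ∀ᶠ t in 𝓝 (0 : ℝ), ∑ i, (b i * height σ (x t i)) • x t i = 0 := by
      filter_upwards [hpos, hcong] with t h1 h2
      refine sum_height_smul_eq_zero hσ h1 h0 (fun i j => ?_) (by simpa only [hb] using hc)
        (by simpa only [hb] using hcx)
      by_cases hij : i = j
      · subst hij; simp [liftSqDist]
      · exact modelEdgeFunction_eq_iff.1 h2 i j hij
    have hd : HasDerivAt (fun t => ∑ i, (b i * height σ (x t i)) • x t i)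
        (∑ i, c i • euclidVel σ (x 0 i) (x' i)) 0 := by
      refine HasDerivAt.fun_sum fun i _ => ?_
      refine (((hasDerivAt_height (hx i) (h0 i)).const_mul (b i)).smul (hx i)).congr_deriv ?_
      rw [← hb i, euclidVel, smul_sub, smul_smul, sub_eq_add_neg, ← neg_smul]
      congr 2
      ring
    exact hd.unique ((hasDerivAt_const (0 : ℝ) (0 : E m)).congr_of_eventuallyEq hzero)
  · by_cases hij : i = j
    · subst hij; simp
    · exact (hasDerivAt_modelEdgeFunction_iff hσ' ⊤ hx h0).1
        ((hasDerivAt_const (0 : ℝ) _).congr_of_eventuallyEq hcong) i j hij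

/-- `(G, p)` has a symmetric finite flex in the projective model of curvature `σ`. -/
def HasModelFlex (σ : ℝ) (Φ : S →* (G ≃g G)) (p : V → E m) : Prop :=
  ∃ x : ℝ → V → E m, (∀ i, AnalyticOn ℝ (fun t => x t i) (Set.Icc 0 1)) ∧ x 0 = p ∧
    (∀ t ∈ Set.Icc (0 : ℝ) 1, ∀ i, 0 < 1 + σ * ‖x t i‖ ^ 2) ∧
    (∀ t ∈ Set.Icc (0 : ℝ) 1, modelEdgeFunction σ G (x t) = modelEdgeFunction σ G p) ∧
    (∀ t ∈ Set.Ioc (0 : ℝ) 1, modelEdgeFunction σ ⊤ (x t) ≠ modelEdgeFunction σ ⊤ p) ∧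
    ∀ t ∈ Set.Icc (0 : ℝ) 1, IsSymmetric Φ (x t)

theorem eventually_forall_pos [Finite V] {y : V → E m} (hy : ∀ i, 0 < 1 + σ * ‖y i‖ ^ 2) :
    ∀ᶠ z in 𝓝 y, ∀ i, 0 < 1 + σ * ‖z i‖ ^ 2 := by
  refine eventually_all.2 fun i => ?_
  have : Continuous fun z : V → E m => 1 + σ * ‖z i‖ ^ 2 := by fun_prop
  exact this.continuousAt.eventually (lt_mem_nhds (hy i))

theorem eventually_symConfigs_forall_pos [Finite V] {y : symConfigs Φ}
    (hy : ∀ i, 0 < 1 + σ * ‖y.1 i‖ ^ 2) :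
    ∀ᶠ z : symConfigs Φ in 𝓝 y, ∀ i, 0 < 1 + σ * ‖z.1 i‖ ^ 2 := by
  have h : Tendsto (fun z : symConfigs Φ => z.1) (𝓝 y) (𝓝 y.1) :=
    (symConfigs Φ).subtypeL.continuous.tendsto y
  exact h.eventually (eventually_forall_pos hy)

/-- Maximal rank integrates the motion to an analytic path, and analyticity of all pairwise
distances prevents congruent configurations from accumulating at time 0 unless the path is congruent
throughout a neighbourhood. -/
theorem hasModelFlex_of_hasSymmetricInfFlex [Fintype V] (hσ : σ = 0 ∨ σ = 1 ∨ σ = -1)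
    {y₀ : symConfigs Φ} (hpos : ∀ i, 0 < 1 + σ * ‖y₀.1 i‖ ^ 2)
    (hmax : ∀ y : symConfigs Φ, symRank Φ y ≤ symRank Φ y₀) (h : HasSymmetricInfFlex Φ y₀.1) :
    HasModelFlex σ Φ y₀.1 := by
  classical
  have hσ' : σ = 0 ∨ σ ^ 2 = 1 := by rcases hσ with rfl | rfl | rfl <;> norm_num
  obtain ⟨u, huinf, husym, hutriv⟩ := h
  let f : symConfigs Φ → G.edgeSet → ℝ := fun y => modelEdgeFunction σ G (y : V → E m)
  have hposev := eventually_symConfigs_forall_pos (y := y₀) hpos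
  let k : symConfigs Φ := (velEquiv σ y₀ hpos).symm ⟨u, husym⟩
  have hku : ∀ i, euclidVel σ (y₀.1 i) (k.1 i) = u i := fun i => euclidVel_modelVel (hpos i) _
  have hk : fderiv ℝ f y₀ k = 0 := by
    rw [fderiv_modelEdgeFunction_eq_zero_iff hσ' G hpos]
    simpa only [hku] using huinf
  obtain ⟨x, hxan, hx0, hxd, hxf⟩ := exists_analytic_path_in_fiber
    (contDiffAt_modelEdgeFunction (σ := σ) G (y := y₀) hpos)
    (hposev.mono fun y hy => by
      rw [finrank_range_fderiv_modelEdgeFunction hσ' y hy,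
        finrank_range_fderiv_modelEdgeFunction hσ' y₀ hpos]
      exact hmax y) hk
  have hxt : Tendsto x (𝓝 0) (𝓝 y₀) := by
    have := hxan.continuousAt.tendsto
    rwa [hx0] at this
  have hcoe : ∀ i, AnalyticAt ℝ (fun t => (x t).1 i) 0 := fun i =>
    ((ContinuousLinearMap.proj (R := ℝ) (φ := fun _ : V => E m) i).comp
      (symConfigs Φ).subtypeL).analyticAt _ |>.comp hxan
  have hKan : AnalyticAt ℝ (fun t => modelEdgeFunction σ (⊤ : SimpleGraph V) (x t).1) 0 := by
    have h1 := (contDiffAt_modelEdgeFunction (σ := σ) (⊤ : SimpleGraph V) (y := y₀) hpos).analyticAt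
    rw [← hx0] at h1
    exact h1.comp hxan
  rcases hKan.eventually_eq_or_eventually_ne (analyticAt_const
    (v := modelEdgeFunction σ (⊤ : SimpleGraph V) y₀.1)) with heq | hne
  · exfalso
    have hx0' : (x 0).1 = y₀.1 := congrArg Subtype.val hx0
    have h1 := exists_trivial_of_congruent_path hσ (x := fun t => (x t).1) (x' := k.1)
      (fun i => ((ContinuousLinearMap.proj (R := ℝ) (φ := fun _ : V => E m) i).comp
        (symConfigs Φ).subtypeL).hasFDerivAt.comp_hasDerivAt 0 hxd)
      (by rw [hx0']; exact hpos) (hxt.eventually hposev) (by rw [hx0']; exact heq)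
    simp only [hx0', hku] at h1
    exact hutriv h1
  · have hall : ∀ᶠ t in 𝓝 (0 : ℝ), (∀ i, AnalyticAt ℝ (fun t => (x t).1 i) t) ∧
        (∀ i, 0 < 1 + σ * ‖(x t).1 i‖ ^ 2) ∧ f (x t) = f y₀ ∧
        (t ≠ 0 → modelEdgeFunction σ (⊤ : SimpleGraph V) (x t).1 ≠ modelEdgeFunction σ ⊤ y₀.1) :=
      (eventually_all.2 fun i => (hcoe i).eventually_analyticAt).and
        ((hxt.eventually hposev).and (hxf.and (eventually_nhdsWithin_iff.1 hne)))
    obtain ⟨ε, hε, hball⟩ := Metric.eventually_nhds_iff_ball.1 hall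
    -- The factor `ε / 2` keeps the whole closed unit interval, endpoint included, inside the open
    -- ball.
    have hmem : ∀ t ∈ Set.Icc (0 : ℝ) 1, ε / 2 * t ∈ Metric.ball (0 : ℝ) ε := fun t ht => by
      rw [mem_ball_zero_iff, Real.norm_eq_abs, abs_of_nonneg (by have := ht.1; positivity)]
      nlinarith [ht.1, ht.2]
    refine ⟨fun t => (x (ε / 2 * t)).1, fun i t ht => ?_, by simp [hx0], fun t ht =>
      (hball _ (hmem t ht)).2.1, fun t ht => (hball _ (hmem t ht)).2.2.1, fun t ht =>
      (hball _ (hmem t (Set.Ioc_subset_Icc_self ht))).2.2.2 (by have := ht.1; positivity),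
      fun t ht => (x (ε / 2 * t)).2⟩
    have h1 := (hball _ (hmem t ht)).1 i
    exact (AnalyticAt.comp (g := fun t => (x t).1 i) h1
      (analyticAt_const.mul analyticAt_id)).analyticWithinAt

end ModelFlexes

/-! ### From finite to infinitesimal flexes -/

theorem exists_linearIndependent_mem {P : Type*} [AddCommGroup P] [Module ℝ P]
    [FiniteDimensional ℝ P] (K : Submodule ℝ P) :
    ∃ b : Fin (Module.finrank ℝ K) → P, LinearIndependent ℝ b ∧ ∀ n, b n ∈ K :=
  ⟨fun n => Module.finBasis ℝ K n,
    (Module.finBasis ℝ K).linearIndependent.map' K.subtype (Submodule.ker_subtype _),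
    fun n => (Module.finBasis ℝ K n).2⟩

/-- If a continuous family of vectors in the kernels of the derivative of `f` is a basis of the
kernel at `p`, then it spans the kernels at all nearby points. -/
theorem eventually_ker_fderiv_le_span {P F : Type*} [NormedAddCommGroup P] [NormedSpace ℝ P]
    [FiniteDimensional ℝ P] [NormedAddCommGroup F] [NormedSpace ℝ F]
    {f : P → F} {p : P} (hf : ContDiffAt ℝ 1 f p) {ι : Type*} [Fintype ι] {τ : P → ι → P}
    (hτ : ContinuousAt τ p) (hli : LinearIndependent ℝ (τ p))
    (hcard : Fintype.card ι = Module.finrank ℝ (LinearMap.ker (fderiv ℝ f p).toLinearMap))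
    (hker : ∀ᶠ y in 𝓝 p, ∀ n, fderiv ℝ f y (τ y n) = 0) :
    ∀ᶠ y in 𝓝 p, LinearMap.ker (fderiv ℝ f y).toLinearMap ≤
      Submodule.span ℝ (Set.range (τ y)) := by
  set r := Module.finrank ℝ (LinearMap.range (fderiv ℝ f p).toLinearMap) with hr
  have hrank : ∀ᶠ y in 𝓝 p, (r : Cardinal) ≤ (fderiv ℝ f y).toLinearMap.rank := by
    have hc : ContinuousAt (fun y => fderiv ℝ f y) p :=
      (hf.fderiv_right (m := 0) (by simp)).continuousAt
    refine hc.eventually ((isOpen_setOfPred_nat_le_rank r).mem_nhds ?_)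
    change (r : Cardinal) ≤ (fderiv ℝ f p).toLinearMap.rank
    rw [LinearMap.rank, ← Module.finrank_eq_rank]
  filter_upwards [hτ.eventually hli.eventually, hrank, hker] with y h1 h2 h3
  have hle : Submodule.span ℝ (Set.range (τ y)) ≤
      LinearMap.ker (fderiv ℝ f y).toLinearMap := by
    rw [Submodule.span_le]
    rintro _ ⟨n, rfl⟩
    exact h3 n
  -- The rank cannot drop nearby, so the kernel has dimension at most the number of the vectors `τ y
  -- n`, which remain independent.
  have h4 := finrank_span_eq_card h1
  rw [LinearMap.rank, ← Module.finrank_eq_rank] at h2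
  have h5 : r ≤ Module.finrank ℝ (LinearMap.range (fderiv ℝ f y).toLinearMap) := by
    exact_mod_cast h2
  have h6 := LinearMap.finrank_range_add_finrank_ker (fderiv ℝ f y).toLinearMap
  have h7 := LinearMap.finrank_range_add_finrank_ker (fderiv ℝ f p).toLinearMap
  exact (Submodule.eq_of_le_of_finrank_le hle (by omega)).ge

section Rigidity

variable {V : Type*} {G : SimpleGraph V} {m : ℕ} {σ : ℝ}
  {S : Subgroup (E m ≃ₗᵢ[ℝ] E m)} {Φ : S →* (G ≃g G)}

theorem IsSymmetric.affine {y : V → E m} (hy : IsSymmetric Φ y) {A : E m →ₗ[ℝ] E m} {t : E m}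
    (hA : ∀ (x : S) (a : E m), (x : E m ≃ₗᵢ[ℝ] E m) (A a) = A ((x : E m ≃ₗᵢ[ℝ] E m) a))
    (ht : ∀ x : S, (x : E m ≃ₗᵢ[ℝ] E m) t = t) : IsSymmetric Φ fun i => A (y i) + t :=
  fun x i => by rw [map_add, hA, ht, hy x i]

theorem isInfMotion_affine {G : SimpleGraph V} {y : V → E m} {A : E m →ₗ[ℝ] E m}
    (hA : IsSkew (euclidForm m) A) (t : E m) :
    IsInfMotion (euclidForm m) G y fun i => A (y i) + t := by
  rw [isInfMotion_euclid_iff]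
  intro i j _
  rw [add_sub_add_right_eq_sub, ← map_sub]
  have h := isSkew_euclid_iff.1 hA (y i - y j) (y i - y j)
  rw [real_inner_comm] at h
  linarith

/-- If all symmetric infinitesimal motions of a configuration are trivial, then at all nearby
symmetric configurations they preserve all distances to first order. -/
theorem eventually_isInfMotion_top [Fintype V] (hσ : σ = 0 ∨ σ ^ 2 = 1) {y₀ : symConfigs Φ}
    (hpos : ∀ i, 0 < 1 + σ * ‖y₀.1 i‖ ^ 2) (h : ¬ HasSymmetricInfFlex Φ y₀.1) :
    ∀ᶠ y : symConfigs Φ in 𝓝 y₀, ∀ k : symConfigs Φ,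
      (IsInfMotion (euclidForm m) G y.1 fun i => euclidVel σ (y.1 i) (k.1 i)) →
      IsInfMotion (euclidForm m) ⊤ y.1 fun i => euclidVel σ (y.1 i) (k.1 i) := by
  classical
  let f : symConfigs Φ → G.edgeSet → ℝ := fun y => modelEdgeFunction σ G (y : V → E m)
  have hf : ContDiffAt ℝ ω f y₀ := contDiffAt_modelEdgeFunction G hpos
  obtain ⟨b, hbli, hbker⟩ := exists_linearIndependent_mem
    (LinearMap.ker (fderiv ℝ f y₀).toLinearMap)
  have hgen : ∀ n, ∃ (A : E m →ₗ[ℝ] E m) (t : E m), IsSkew (euclidForm m) A ∧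
      (∀ i, euclidVel σ (y₀.1 i) ((b n).1 i) = A (y₀.1 i) + t) ∧
      (∀ (x : S) (a : E m), (x : E m ≃ₗᵢ[ℝ] E m) (A a) = A ((x : E m ≃ₗᵢ[ℝ] E m) a)) ∧
      ∀ x : S, (x : E m ≃ₗᵢ[ℝ] E m) t = t := by
    intro n
    have h1 := (fderiv_modelEdgeFunction_eq_zero_iff hσ G hpos (b n)).1 (hbker n)
    have h2 : IsSymmetric Φ fun i => euclidVel σ (y₀.1 i) ((b n).1 i) :=
      IsSymmetric.euclidVel y₀.2 (b n).2
    by_contra hcon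
    refine h ⟨_, h1, h2, ?_⟩
    rintro ⟨A, t, hA, hAt⟩
    exact hcon (exists_invariant_generator y₀.2 h2 hA hAt)
  choose A t hA hAt hAx htx using hgen
  -- The infinitesimal isometries found at `y₀` are restricted to a varying configuration `y`. The
  -- result is symmetric because they commute with `S`, and it preserves all pairwise distances to
  -- first order.
  let τ : symConfigs Φ → Fin _ → symConfigs Φ :=
    fun y n => ⟨fun i => modelVel σ (y.1 i) (A n (y.1 i) + t n),
      IsSymmetric.modelVel y.2 (IsSymmetric.affine y.2 (hAx n) (htx n))⟩
  have hτ₀ : τ y₀ = b := by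
    funext n
    refine Subtype.ext (funext fun i => ?_)
    change modelVel σ (y₀.1 i) (A n (y₀.1 i) + t n) = _
    rw [← hAt, modelVel_euclidVel (hpos i)]
  have hτc : Continuous τ := by
    refine continuous_pi fun n => Continuous.subtype_mk (continuous_pi fun i => ?_) _
    have h1 : Continuous fun y : symConfigs Φ => y.1 i :=
      ((ContinuousLinearMap.proj i).comp (symConfigs Φ).subtypeL).continuous
    have h2 : Continuous fun y : symConfigs Φ => A n (y.1 i) + t n :=
      ((A n).continuous_of_finiteDimensional.comp h1).add continuous_const
    have h3 : Continuous fun y : symConfigs Φ => σ * inner ℝ (y.1 i) (A n (y.1 i) + t n) :=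
      continuous_const.mul (h1.inner h2)
    exact h2.add (h3.smul h1)
  have hmot : ∀ (G' : SimpleGraph V) (y : symConfigs Φ), (∀ i, 0 < 1 + σ * ‖y.1 i‖ ^ 2) → ∀ n,
      fderiv ℝ (fun y : symConfigs Φ => modelEdgeFunction σ G' (y : V → E m)) y (τ y n) = 0 := by
    intro G' y hy n
    rw [fderiv_modelEdgeFunction_eq_zero_iff hσ G' hy]
    have h3 : (fun i => euclidVel σ (y.1 i) ((τ y n).1 i)) = fun i => A n (y.1 i) + t n :=
      funext fun i => euclidVel_modelVel (hy i) _
    rw [h3]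
    exact isInfMotion_affine (hA n) (t n)
  have hposev := eventually_symConfigs_forall_pos hpos
  filter_upwards [hposev, eventually_ker_fderiv_le_span (hf.of_le le_top) hτc.continuousAt
    (hτ₀.symm ▸ hbli) (Fintype.card_fin _) (hposev.mono (hmot G))] with y hy hspan k hk
  have hleT : Submodule.span ℝ (Set.range (τ y)) ≤ LinearMap.ker (fderiv ℝ
      (fun y : symConfigs Φ => modelEdgeFunction σ (⊤ : SimpleGraph V) (y : V → E m))
      y).toLinearMap := by
    rw [Submodule.span_le]
    rintro _ ⟨n, rfl⟩
    exact hmot ⊤ y hy n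
  exact (fderiv_modelEdgeFunction_eq_zero_iff hσ ⊤ hy k).1
    (hleT (hspan ((fderiv_modelEdgeFunction_eq_zero_iff hσ G hy k).2 hk)))

/-- Without an infinitesimal flex, the velocity of a path preserving the bars preserves every
pairwise distance to first order near the start, so an initial piece of the path is congruent to
`y₀`. Maximality of the rank plays no role in this direction. -/
theorem hasSymmetricInfFlex_of_hasModelFlex [Fintype V] (hσ : σ = 0 ∨ σ ^ 2 = 1)
    {y₀ : symConfigs Φ} (h : HasModelFlex σ Φ y₀.1) : HasSymmetricInfFlex Φ y₀.1 := by
  classical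
  obtain ⟨x, hxan, hx0, hxpos, hxbars, hxnon, hxsym⟩ := h
  by_contra hcon
  have hpos : ∀ i, 0 < 1 + σ * ‖y₀.1 i‖ ^ 2 := by
    have := hxpos 0 (by simp)
    rwa [hx0] at this
  -- Outside the unit interval the path need not be symmetric. Projecting by `ρ` yields a path in
  -- `symConfigs Φ` for all times, unchanged on the interval.
  obtain ⟨ρ, hρ⟩ := Submodule.ClosedComplemented.of_finiteDimensional (symConfigs Φ)
  let X : ℝ → symConfigs Φ := fun t => ρ (x t)
  have hX : ∀ t ∈ Set.Icc (0 : ℝ) 1, (X t).1 = x t := fun t ht =>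
    congrArg Subtype.val (hρ ⟨x t, hxsym t ht⟩)
  have hX0 : X 0 = y₀ := Subtype.ext ((hX 0 (by simp)).trans hx0)
  have hxc : ContinuousOn x (Set.Icc 0 1) :=
    continuousOn_pi.2 fun i => (hxan i).continuousOn
  have hXc : ContinuousOn X (Set.Icc 0 1) := ρ.continuous.comp_continuousOn hxc
  have hev : ∀ᶠ t in 𝓝[Set.Icc 0 1] (0 : ℝ), ∀ k : symConfigs Φ,
      (IsInfMotion (euclidForm m) G (X t).1 fun i => euclidVel σ ((X t).1 i) (k.1 i)) →
      IsInfMotion (euclidForm m) ⊤ (X t).1 fun i => euclidVel σ ((X t).1 i) (k.1 i) := by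
    have h1 := hXc 0 (by simp)
    rw [ContinuousWithinAt, hX0] at h1
    exact h1.eventually (eventually_isInfMotion_top hσ hpos hcon)
  obtain ⟨ε, hε, hball⟩ := Metric.eventually_nhds_iff_ball.1 (eventually_nhdsWithin_iff.1 hev)
  set T := min (ε / 2) 1 with hT
  have hT0 : 0 < T := lt_min (by positivity) one_pos
  have hT1 : T ≤ 1 := min_le_right _ _
  have hTε : T < ε := (min_le_left _ _).trans_lt (by linarith)
  refine hxnon T ⟨hT0, hT1⟩ (modelEdgeFunction_eq_iff.2 fun i j hij => ?_)
  have hderiv : ∀ s ∈ Set.Ioo 0 T,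
      HasDerivAt (fun t => liftSqDist σ ((X t).1 i) ((X t).1 j)) 0 s := by
    intro s hs
    have hs01 : s ∈ Set.Icc (0 : ℝ) 1 := ⟨hs.1.le, hs.2.le.trans hT1⟩
    have hnhds : Set.Icc (0 : ℝ) 1 ∈ 𝓝 s := Icc_mem_nhds hs.1 (hs.2.trans_le hT1)
    have hxd : ∀ i, HasDerivAt (fun t => x t i) (deriv (fun t => x t i) s) s := fun i =>
      (((hxan i).differentiableOn s hs01).differentiableAt hnhds).hasDerivAt
    have hXd : HasDerivAt X (ρ fun i => deriv (fun t => x t i) s) s :=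
      ρ.hasFDerivAt.comp_hasDerivAt s (hasDerivAt_pi.2 hxd)
    set k : symConfigs Φ := ρ fun i => deriv (fun t => x t i) s
    have hXdi : ∀ i, HasDerivAt (fun t => (X t).1 i) (k.1 i) s := fun i =>
      ((ContinuousLinearMap.proj i).comp
        (symConfigs Φ).subtypeL).hasFDerivAt.comp_hasDerivAt s hXd
    have hXpos : ∀ i, 0 < 1 + σ * ‖(X s).1 i‖ ^ 2 := by
      rw [hX s hs01]; exact hxpos s hs01
    have hbars : HasDerivAt (fun t => modelEdgeFunction σ G (X t).1) 0 s := by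
      refine (hasDerivAt_const s (modelEdgeFunction σ G y₀.1)).congr_of_eventuallyEq ?_
      filter_upwards [hnhds] with t ht
      rw [hX t ht, hxbars t ht]
    have h1 := (hasDerivAt_modelEdgeFunction_iff hσ G hXdi hXpos).1 hbars
    have h2 := hball s (by
      rw [mem_ball_zero_iff, Real.norm_eq_abs, abs_of_pos hs.1]; exact hs.2.trans hTε) hs01 k h1
    have h3 := (hasDerivAt_modelEdgeFunction_iff hσ ⊤ hXdi hXpos).2 h2
    exact hasDerivAt_pi.1 h3 ⟨s(i, j), hij⟩
  have hcont : ContinuousOn (fun t => liftSqDist σ ((X t).1 i) ((X t).1 j)) (Set.Icc 0 T) := by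
    intro t ht
    have ht1 : t ∈ Set.Icc (0 : ℝ) 1 := ⟨ht.1, ht.2.trans hT1⟩
    have hXpos : ∀ i, 0 < 1 + σ * ‖(X t).1 i‖ ^ 2 := by
      rw [hX t ht1]; exact hxpos t ht1
    have h1 := (contDiffAt_modelEdgeFunction (σ := σ) (⊤ : SimpleGraph V) (y := X t)
      hXpos).continuousAt
    have h2 : ContinuousAt (fun y : symConfigs Φ => liftSqDist σ (y.1 i) (y.1 j)) (X t) :=
      continuousAt_pi.1 h1 ⟨s(i, j), hij⟩
    exact h2.comp_continuousWithinAt ((hXc t ht1).mono (Set.Icc_subset_Icc_right hT1))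
  -- The mean value theorem needs derivatives only on the open interval, where the one-sided
  -- analyticity hypothesis gives genuine differentiability.
  obtain ⟨c, hc, hslope⟩ := exists_deriv_eq_slope _ hT0 hcont
    (fun s hs => (hderiv s hs).differentiableAt.differentiableWithinAt)
  rw [(hderiv c hc).deriv, eq_comm, div_eq_zero_iff] at hslope
  have h1 := sub_eq_zero.1 (hslope.resolve_right (by linarith))
  rw [hX T ⟨hT0.le, hT1⟩, hX0] at h1
  exact h1

end Rigidity

/-! ### Points over the projective model -/

/-- The first `d` coordinates. -/
def trunc (d : ℕ) : E (d + 1) →ₗ[ℝ] E d where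
  toFun a := WithLp.toLp 2 fun k => a k.castSucc
  map_add' _ _ := rfl
  map_smul' _ _ := rfl

/-- The vector with first coordinates `v` and last coordinate `c`. -/
def snocVec {d : ℕ} (v : E d) (c : ℝ) : E (d + 1) :=
  WithLp.toLp 2 (Fin.snoc (α := fun _ => ℝ) v c)

section Coordinates

variable {d : ℕ}

@[simp] theorem trunc_snocVec (v : E d) (c : ℝ) : trunc d (snocVec v c) = v := by
  ext k
  change (snocVec v c) k.castSucc = v k
  simp [snocVec]

@[simp] theorem snocVec_last (v : E d) (c : ℝ) : snocVec v c (Fin.last d) = c := by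
  simp [snocVec]

theorem ext_trunc_last {a b : E (d + 1)} (h : trunc d a = trunc d b)
    (hl : a (Fin.last d) = b (Fin.last d)) : a = b := by
  ext k
  refine Fin.lastCases hl (fun k => ?_) k
  exact congrArg (fun v : E d => v k) h

theorem snocVec_trunc_last (a : E (d + 1)) : snocVec (trunc d a) (a (Fin.last d)) = a :=
  ext_trunc_last (trunc_snocVec _ _) (snocVec_last _ _)

theorem smul_snocVec (r : ℝ) (v : E d) (c : ℝ) : r • snocVec v c = snocVec (r • v) (r * c) :=
  ext_trunc_last (by simp) (by simp)

theorem snocVec_add (v w : E d) (b c : ℝ) :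
    snocVec (v + w) (b + c) = snocVec v b + snocVec w c :=
  ext_trunc_last (by simp) (by simp)

/-- The inclusion of `E d` as the hyperplane where the last coordinate vanishes. -/
def incl (d : ℕ) : E d →ₗ[ℝ] E (d + 1) where
  toFun v := snocVec v 0
  map_add' v w := by rw [← snocVec_add, add_zero]
  map_smul' r v := by rw [RingHom.id_apply, smul_snocVec, mul_zero]

theorem snocVec_eq (v : E d) (c : ℝ) : snocVec v c = incl d v + c • snocVec 0 1 :=
  ext_trunc_last (by simp [incl]) (by simp [incl])

theorem centralProj_eq (a : E (d + 1)) :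
    centralProj d a = (a (Fin.last d))⁻¹ • trunc d a := by
  ext k
  change a k.castSucc / a (Fin.last d) = (a (Fin.last d))⁻¹ * a k.castSucc
  rw [div_eq_inv_mul]

theorem star_apply (x : E d ≃ₗᵢ[ℝ] E d) (a : E (d + 1)) :
    star x a = snocVec (x (trunc d a)) (a (Fin.last d)) := rfl

theorem centralProj_star (x : E d ≃ₗᵢ[ℝ] E d) (a : E (d + 1)) :
    centralProj d (star x a) = x (centralProj d a) := by
  rw [centralProj_eq, centralProj_eq, star_apply, trunc_snocVec, snocVec_last, map_smul]

/-- The point over `y` on the quadric of curvature `σ`. -/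
def lift (σ : ℝ) (y : E d) : E (d + 1) := height σ y • snocVec y 1

theorem lift_last (σ : ℝ) (y : E d) : lift σ y (Fin.last d) = height σ y := by simp [lift]

theorem trunc_lift (σ : ℝ) (y : E d) : trunc d (lift σ y) = height σ y • y := by simp [lift]

theorem centralProj_lift {σ : ℝ} {y : E d} (hy : 0 < 1 + σ * ‖y‖ ^ 2) :
    centralProj d (lift σ y) = y := by
  rw [centralProj_eq, lift_last, trunc_lift, smul_smul, inv_mul_cancel₀ (height_pos hy).ne',
    one_smul]

end Coordinates

/-! ### The hemisphere and hyperbolic space as quadrics -/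

/-- `B` and `M` are the bilinear form and the upper half of the quadric of curvature `σ`. -/
structure IsQuadricModel {d : ℕ} (σ : ℝ) (B : E (d + 1) →ₗ[ℝ] E (d + 1) →ₗ[ℝ] ℝ)
    (M : Set (E (d + 1))) : Prop where
  sign : σ = 1 ∨ σ = -1
  form : ∀ a b, B a b = inner ℝ (trunc d a) (trunc d b) + σ * (a (Fin.last d) * b (Fin.last d))
  mem : ∀ a, a ∈ M ↔ B a a = σ ∧ 0 < a (Fin.last d)

theorem isQuadricModel_hemisphere (d : ℕ) :
    IsQuadricModel 1 (euclidForm (d + 1)) (hemisphere d) where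
  sign := Or.inl rfl
  form a b := by
    change inner ℝ a b = _
    rw [PiLp.inner_apply, Fin.sum_univ_castSucc, PiLp.inner_apply, one_mul]
    congr 1
    exact mul_comm _ _
  mem _ := Iff.rfl

theorem isQuadricModel_hyperbolicSpace (d : ℕ) :
    IsQuadricModel (-1) (minkForm d) (hyperbolicSpace d) where
  sign := Or.inr rfl
  form a b := by
    change ∑ k : Fin d, a k.castSucc * b k.castSucc - a (Fin.last d) * b (Fin.last d) = _
    rw [PiLp.inner_apply, neg_one_mul, ← sub_eq_add_neg]
    congr 1
    exact Finset.sum_congr rfl fun k _ => mul_comm _ _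
  mem _ := Iff.rfl

namespace IsQuadricModel

variable {d : ℕ} {σ : ℝ} {B : E (d + 1) →ₗ[ℝ] E (d + 1) →ₗ[ℝ] ℝ} {M : Set (E (d + 1))}

theorem sq_eq_one (h : IsQuadricModel σ B M) : σ ^ 2 = 1 := by
  rcases h.sign with rfl | rfl <;> norm_num

/-- Multiply the equation of the quadric by `σ` and divide by the square of the last coordinate.
Both the positivity condition of the model and the formula for `height` follow from this. -/
theorem one_add_mul_centralProj (h : IsQuadricModel σ B M) {a : E (d + 1)} (ha : a ∈ M) :
    1 + σ * ‖centralProj d a‖ ^ 2 = ((a (Fin.last d))⁻¹) ^ 2 := by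
  obtain ⟨h1, h2⟩ := (h.mem a).1 ha
  rw [h.form, real_inner_self_eq_norm_sq] at h1
  rw [centralProj_eq, norm_smul, mul_pow, Real.norm_eq_abs, sq_abs]
  have h3 : (a (Fin.last d))⁻¹ ^ 2 * a (Fin.last d) ^ 2 = 1 := by
    rw [← mul_pow, inv_mul_cancel₀ h2.ne', one_pow]
  linear_combination σ * (a (Fin.last d))⁻¹ ^ 2 * h1 - σ ^ 2 * h3 +
    ((a (Fin.last d))⁻¹ ^ 2 - 1) * h.sq_eq_one

theorem pos_of_mem (h : IsQuadricModel σ B M) {a : E (d + 1)} (ha : a ∈ M) :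
    0 < 1 + σ * ‖centralProj d a‖ ^ 2 := by
  rw [h.one_add_mul_centralProj ha]
  exact pow_pos (inv_pos.2 ((h.mem a).1 ha).2) 2

theorem height_centralProj (h : IsQuadricModel σ B M) {a : E (d + 1)} (ha : a ∈ M) :
    height σ (centralProj d a) = a (Fin.last d) := by
  rw [height, h.one_add_mul_centralProj ha,
    Real.sqrt_sq (inv_pos.2 ((h.mem a).1 ha).2).le, inv_inv]

theorem lift_centralProj (h : IsQuadricModel σ B M) {a : E (d + 1)} (ha : a ∈ M) :
    lift σ (centralProj d a) = a := by
  refine ext_trunc_last ?_ ?_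
  · rw [trunc_lift, h.height_centralProj ha, centralProj_eq, smul_smul,
      mul_inv_cancel₀ ((h.mem a).1 ha).2.ne', one_smul]
  · rw [lift_last, h.height_centralProj ha]

theorem form_lift_sub (h : IsQuadricModel σ B M) (y z : E d) :
    B (lift σ y - lift σ z) (lift σ y - lift σ z) = liftSqDist σ y z := by
  rw [h.form, map_sub, trunc_lift, trunc_lift, real_inner_self_eq_norm_sq, PiLp.sub_apply,
    lift_last, lift_last, liftSqDist, sq (height σ y - height σ z)]

theorem form_sub (h : IsQuadricModel σ B M) {a b : E (d + 1)} (ha : a ∈ M) (hb : b ∈ M) :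
    B (a - b) (a - b) = liftSqDist σ (centralProj d a) (centralProj d b) := by
  rw [← h.form_lift_sub, h.lift_centralProj ha, h.lift_centralProj hb]

theorem lift_mem (h : IsQuadricModel σ B M) {y : E d} (hy : 0 < 1 + σ * ‖y‖ ^ 2) :
    lift σ y ∈ M := by
  rw [h.mem, h.form, lift_last, trunc_lift, real_inner_self_eq_norm_sq, norm_smul, mul_pow,
    Real.norm_eq_abs, sq_abs]
  refine ⟨?_, height_pos hy⟩
  linear_combination σ * height_sq_mul hy - height σ y ^ 2 * ‖y‖ ^ 2 * h.sq_eq_one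

theorem edgeFunction_eq_iff (h : IsQuadricModel σ B M) {V : Type*} {G : SimpleGraph V}
    {w z : V → E (d + 1)} (hw : ∀ i, w i ∈ M) (hz : ∀ i, z i ∈ M) :
    edgeFunction B G w = edgeFunction B G z ↔
      modelEdgeFunction σ G (fun i => centralProj d (w i)) =
        modelEdgeFunction σ G fun i => centralProj d (z i) := by
  rw [SymFramework.edgeFunction_eq_iff, modelEdgeFunction_eq_iff]
  simp only [h.form_sub (hw _) (hw _), h.form_sub (hz _) (hz _)]

end IsQuadricModel

/-! ### Transfer of symmetry -/

section Transfer

variable {V : Type*} {G : SimpleGraph V} {d : ℕ} {S : Subgroup (E d ≃ₗᵢ[ℝ] E d)}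
  {Φ : S →* (G ≃g G)} {Ψ : starGroup S →* (G ≃g G)}

/-- The element `x*` of `S*`. -/
def starElt (x : S) : starGroup S := ⟨star x, x, x.2, rfl⟩

theorem starElt_surjective : Function.Surjective (starElt (S := S)) := by
  rintro ⟨_, x, hx, rfl⟩
  exact ⟨⟨x, hx⟩, rfl⟩

/-- The frameworks with types `Φ` and `Ψ` that correspond under central projection have the same
type. -/
theorem type_eq_of_centralProj {p : V → E d} {q : V → E (d + 1)} (hp : IsFramework Φ p)
    (hq : IsSymmetric Ψ q) (hqp : ∀ i, centralProj d (q i) = p i) (x : S) (i : V) :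
    Ψ (starElt x) i = Φ x i := by
  refine hp.1 ?_
  rw [← hqp, ← hq, ← hp.2, ← hqp]
  exact centralProj_star _ _

theorem isSymmetric_starGroup_iff (hΨ : ∀ (x : S) i, Ψ (starElt x) i = Φ x i)
    {w : V → E (d + 1)} : IsSymmetric Ψ w ↔ IsSymmetric Φ (fun i => trunc d (w i)) ∧
      ∀ (x : S) i, w i (Fin.last d) = w (Φ x i) (Fin.last d) := by
  constructor
  · intro h
    have h1 : ∀ (x : S) i, snocVec ((x : E d ≃ₗᵢ[ℝ] E d) (trunc d (w i))) (w i (Fin.last d)) =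
        w (Φ x i) := fun x i => by rw [← hΨ]; exact h (starElt x) i
    refine ⟨fun x i => ?_, fun x i => ?_⟩
    · simp only [← h1, trunc_snocVec]
    · rw [← h1, snocVec_last]
  · rintro ⟨h1, h2⟩ x' i
    obtain ⟨x, rfl⟩ := starElt_surjective x'
    rw [hΨ]
    change snocVec ((x : E d ≃ₗᵢ[ℝ] E d) (trunc d (w i))) (w i (Fin.last d)) = _
    rw [h1 x i, h2 x i, snocVec_trunc_last]

theorem IsSymmetric.centralProj (hΨ : ∀ (x : S) i, Ψ (starElt x) i = Φ x i) {w : V → E (d + 1)}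
    (hw : IsSymmetric Ψ w) : IsSymmetric Φ fun i => centralProj d (w i) := fun x i => by
  have h := hw (starElt x) i
  rw [hΨ] at h
  simp only [← h]
  exact (centralProj_star _ _).symm

theorem IsSymmetric.lift (hΨ : ∀ (x : S) i, Ψ (starElt x) i = Φ x i) {σ : ℝ} {y : V → E d}
    (hy : IsSymmetric Φ y) : IsSymmetric Ψ fun i => lift σ (y i) := by
  rw [isSymmetric_starGroup_iff hΨ]
  refine ⟨fun x i => ?_, fun x i => ?_⟩
  · simp only [trunc_lift, map_smul, hy.height_eq, hy x i]
  · rw [lift_last, lift_last, hy.height_eq]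

variable {σ : ℝ} {B : E (d + 1) →ₗ[ℝ] E (d + 1) →ₗ[ℝ] ℝ} {M : Set (E (d + 1))}

/-- Central projection and `lift` are mutually inverse, analytic and equivariant between `M` and the
model domain, and they match the form's squared distances with `liftSqDist`. -/
theorem hasSymmetricFiniteFlex_iff_hasModelFlex (hB : IsQuadricModel σ B M)
    (hΨ : ∀ (x : S) i, Ψ (starElt x) i = Φ x i) {p : V → E d} {q : V → E (d + 1)}
    (hqM : ∀ i, q i ∈ M) (hqp : ∀ i, centralProj d (q i) = p i) :
    HasSymmetricFiniteFlex M B Ψ q ↔ HasModelFlex σ Φ p := by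
  obtain rfl : (fun i => centralProj d (q i)) = p := funext hqp
  constructor
  · rintro ⟨x, hx, hsym⟩
    refine ⟨fun t i => centralProj d (x t i), fun i => ?_, by simp only [hx.start],
      fun t ht i => hB.pos_of_mem (hx.mem t ht i),
      fun t ht => (hB.edgeFunction_eq_iff (hx.mem t ht) hqM).1 (hx.bars t ht),
      fun t ht h => hx.nontrivial t ht ((hB.edgeFunction_eq_iff
        (hx.mem t (Set.Ioc_subset_Icc_self ht)) hqM).2 h), fun t ht => (hsym t ht).centralProj hΨ⟩
    simp only [centralProj_eq]
    have h1 : AnalyticOn ℝ (fun t => x t i (Fin.last d)) (Set.Icc 0 1) :=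
      (EuclideanSpace.proj (𝕜 := ℝ) (Fin.last d)).comp_analyticOn (hx.analytic i)
    have h2 : AnalyticOn ℝ (fun t => trunc d (x t i)) (Set.Icc 0 1) :=
      (trunc d).toContinuousLinearMap.comp_analyticOn (hx.analytic i)
    exact (h1.inv fun t ht => ((hB.mem _).1 (hx.mem t ht i)).2.ne').smul h2
  · rintro ⟨y, hyan, hy0, hypos, hybars, hynon, hysym⟩
    have hmem : ∀ t ∈ Set.Icc (0 : ℝ) 1, ∀ i, lift σ (y t i) ∈ M := fun t ht i =>
      hB.lift_mem (hypos t ht i)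
    have hproj : ∀ t ∈ Set.Icc (0 : ℝ) 1, (fun i => centralProj d (lift σ (y t i))) = y t :=
      fun t ht => funext fun i => centralProj_lift (hypos t ht i)
    refine ⟨fun t i => lift σ (y t i), ⟨fun i => ?_, ?_, hmem, fun t ht => ?_, fun t ht h => ?_⟩,
      fun t ht => (hysym t ht).lift hΨ⟩
    · have h1 : AnalyticOn ℝ (fun t => height σ (y t i)) (Set.Icc 0 1) := fun t ht =>
        AnalyticAt.comp_analyticWithinAt (g := height σ) (f := fun t => y t i)
          (contDiffAt_height (hypos t ht i)).analyticAt (hyan i t ht)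
      have h2 : AnalyticOn ℝ (fun t => incl d (y t i)) (Set.Icc 0 1) :=
        (incl d).toContinuousLinearMap.comp_analyticOn (hyan i)
      have h3 : (fun t => SymFramework.lift σ (y t i)) =
          fun t => height σ (y t i) • (incl d (y t i) + (1 : ℝ) • snocVec 0 1) :=
        funext fun t => by rw [SymFramework.lift, snocVec_eq]
      rw [h3]
      exact h1.smul (h2.add analyticOn_const)
    · funext i
      simp only [hy0]
      exact hB.lift_centralProj (hqM i)
    · rw [hB.edgeFunction_eq_iff (hmem t ht) hqM, hproj t ht]
      exact hybars t ht
    · have ht' := Set.Ioc_subset_Icc_self ht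
      rw [hB.edgeFunction_eq_iff (hmem t ht') hqM, hproj t ht'] at h
      exact hynon t ht h

theorem hasSymmetricFiniteFlex_euclid_iff_hasModelFlex {p : V → E d} :
    HasSymmetricFiniteFlex Set.univ (euclidForm d) Φ p ↔ HasModelFlex 0 Φ p := by
  simp only [HasModelFlex, modelEdgeFunction_zero]
  constructor
  · rintro ⟨x, hx, hsym⟩
    exact ⟨x, hx.analytic, hx.start, by simp, hx.bars, hx.nontrivial, hsym⟩
  · rintro ⟨x, h1, h2, -, h3, h4, h5⟩
    exact ⟨x, ⟨h1, h2, fun _ _ _ => Set.mem_univ _, h3, h4⟩, h5⟩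

/-! ### Infinitesimal motions -/

/-- The velocity on the quadric of curvature `σ` that corresponds to the Euclidean velocity `u`
at `y`. -/
def liftVel (σ : ℝ) (y u : E d) : E (d + 1) := height σ y • snocVec u (-(σ * inner ℝ y u))

theorem trunc_liftVel (y u : E d) : trunc d (liftVel σ y u) = height σ y • u := by simp [liftVel]

theorem liftVel_last (y u : E d) :
    liftVel σ y u (Fin.last d) = height σ y * -(σ * inner ℝ y u) := by simp [liftVel]

namespace IsQuadricModel

/-- The last coordinate of `liftVel` is chosen for this identity. At `z = y` it gives tangency to
the quadric, and by bilinearity it yields the bar condition. -/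
theorem form_lift_liftVel (hB : IsQuadricModel σ B M) (y z u : E d) :
    B (SymFramework.lift σ z) (liftVel σ y u) =
      height σ y * height σ z * inner ℝ (z - y) u := by
  rw [hB.form, trunc_lift, lift_last, trunc_liftVel, liftVel_last, real_inner_smul_left,
    inner_smul_right, inner_sub_left]
  linear_combination (-height σ z * height σ y * inner ℝ y u) * hB.sq_eq_one

theorem form_lift_sub_liftVel_sub (hB : IsQuadricModel σ B M) (y z u v : E d) :
    B (SymFramework.lift σ y - SymFramework.lift σ z) (liftVel σ y u - liftVel σ z v) =
      height σ y * height σ z * inner ℝ (y - z) (u - v) := by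
  simp only [map_sub, LinearMap.sub_apply, hB.form_lift_liftVel, sub_self, inner_zero_left]
  rw [← neg_sub y z, inner_neg_left, inner_sub_right]
  ring

theorem eq_liftVel (hB : IsQuadricModel σ B M) {y : E d} (hy : 0 < 1 + σ * ‖y‖ ^ 2)
    {v : E (d + 1)} (hv : B (SymFramework.lift σ y) v = 0) :
    v = liftVel σ y ((height σ y)⁻¹ • trunc d v) := by
  have h0 := (height_pos hy).ne'
  refine ext_trunc_last ?_ ?_
  · rw [trunc_liftVel, smul_smul, mul_inv_cancel₀ h0, one_smul]
  · rw [hB.form, trunc_lift, lift_last, real_inner_smul_left] at hv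
    have h1 : inner ℝ y (trunc d v) + σ * v (Fin.last d) = 0 := by
      refine (mul_eq_zero.1 ?_).resolve_left h0
      linear_combination hv
    rw [liftVel_last, inner_smul_right]
    field_simp
    linear_combination σ * h1 - v (Fin.last d) * hB.sq_eq_one

/-- In block form, a skew map for `B` has a Euclidean-skew upper-left block `A`, last column `t`,
last row determined by `t` and `σ`, and zero corner. Its action on the points `(y, 1)` is `A y + t`
in the first coordinates. -/
theorem exists_skew_liftVel_iff (hB : IsQuadricModel σ B M) {p u : V → E d}
    (hp : ∀ i, 0 < 1 + σ * ‖p i‖ ^ 2) :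
    (∃ A : E (d + 1) →ₗ[ℝ] E (d + 1), IsSkew B A ∧
      ∀ i, liftVel σ (p i) (u i) = A (SymFramework.lift σ (p i))) ↔
    ∃ (A : E d →ₗ[ℝ] E d) (t : E d), IsSkew (euclidForm d) A ∧ ∀ i, u i = A (p i) + t := by
  constructor
  · rintro ⟨A, hA, h⟩
    refine ⟨trunc d ∘ₗ A ∘ₗ incl d, trunc d (A (snocVec 0 1)), fun a b => ?_, fun i => ?_⟩
    · have h1 := hA (incl d a) (incl d b)
      rw [hB.form, hB.form] at h1
      change inner ℝ (trunc d (A (incl d a))) b = -inner ℝ a (trunc d (A (incl d b)))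
      simpa [incl] using h1
    · have h1 := h i
      rw [liftVel, SymFramework.lift, map_smul] at h1
      have h2 := congrArg (trunc d) (smul_right_injective _ (height_pos (hp i)).ne' h1)
      rw [trunc_snocVec, snocVec_eq, one_smul, map_add, map_add] at h2
      exact h2
  · rintro ⟨A, t, hA, h⟩
    let A' : E (d + 1) →ₗ[ℝ] E (d + 1) :=
      { toFun := fun a =>
          snocVec (A (trunc d a) + a (Fin.last d) • t) (-(σ * inner ℝ t (trunc d a)))
        map_add' := fun a b => by
          rw [← snocVec_add]
          congr 1
          · simp only [map_add, PiLp.add_apply, add_smul]; abel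
          · simp only [map_add, inner_add_right]; ring
        map_smul' := fun r a => by
          rw [RingHom.id_apply, smul_snocVec]
          congr 1
          · simp only [map_smul, PiLp.smul_apply, smul_add, smul_smul, smul_eq_mul]
          · simp only [map_smul, inner_smul_right]; ring }
    have hA' : ∀ a, A' a =
      snocVec (A (trunc d a) + a (Fin.last d) • t) (-(σ * inner ℝ t (trunc d a))) := fun _ => rfl
    refine ⟨A', fun a b => ?_, fun i => ?_⟩
    · rw [hB.form, hB.form, hA', hA', trunc_snocVec, trunc_snocVec, snocVec_last, snocVec_last,
        inner_add_left, inner_add_right, isSkew_euclid_iff.1 hA, real_inner_smul_left,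
        inner_smul_right, real_inner_comm t (trunc d a)]
      linear_combination (-(inner ℝ t (trunc d a) * b (Fin.last d)) -
        a (Fin.last d) * inner ℝ t (trunc d b)) * hB.sq_eq_one
    · rw [SymFramework.lift, map_smul, hA', trunc_snocVec, snocVec_last, one_smul, liftVel, h i]
      congr 3
      have h1 := isSkew_euclid_iff.1 hA (p i) (p i)
      rw [real_inner_comm] at h1
      rw [inner_add_right, real_inner_comm t]
      have h2 : inner ℝ (p i) (A (p i)) = (0 : ℝ) := by linarith
      rw [h2, zero_add]

/-- Every tangent velocity is a `liftVel`. Bar conditions then differ from the Euclidean ones by a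
product of two heights, and heights are constant on symmetry orbits. -/
theorem hasSymmetricInfFlexOnSphere_iff (hB : IsQuadricModel σ B M)
    (hΨ : ∀ (x : S) i, Ψ (starElt x) i = Φ x i) {p : V → E d} {q : V → E (d + 1)}
    (hp : IsSymmetric Φ p) (hqM : ∀ i, q i ∈ M) (hqp : ∀ i, centralProj d (q i) = p i) :
    HasSymmetricInfFlexOnSphere B Ψ q ↔ HasSymmetricInfFlex Φ p := by
  have hpos : ∀ i, 0 < 1 + σ * ‖p i‖ ^ 2 := fun i => hqp i ▸ hB.pos_of_mem (hqM i)
  obtain rfl : (fun i => SymFramework.lift σ (p i)) = q :=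
    funext fun i => by rw [← hqp, hB.lift_centralProj (hqM i)]
  have hmot : ∀ u : V → E d, IsInfMotion B G (fun i => SymFramework.lift σ (p i))
      (fun i => liftVel σ (p i) (u i)) ↔ IsInfMotion (euclidForm d) G p u := by
    intro u
    refine forall_congr' fun i => forall_congr' fun j => imp_congr_right fun _ => ?_
    rw [hB.form_lift_sub_liftVel_sub]
    exact mul_eq_zero.trans
      (or_iff_right (mul_pos (height_pos (hpos i)) (height_pos (hpos j))).ne')
  constructor
  · rintro ⟨v, h1, h2, h3, h4⟩
    obtain ⟨u, rfl⟩ : ∃ u : V → E d, v = fun i => liftVel σ (p i) (u i) :=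
      ⟨_, funext fun i => hB.eq_liftVel (hpos i) (h2 i)⟩
    refine ⟨u, (hmot u).1 h1, fun x i => ?_, fun h => h4 ((hB.exists_skew_liftVel_iff hpos).2 h)⟩
    have h5 := ((isSymmetric_starGroup_iff hΨ).1 h3).1 x i
    simp only [trunc_liftVel, map_smul, hp.height_eq] at h5
    exact smul_right_injective _ (height_pos (hpos i)).ne' h5
  · rintro ⟨u, h1, h2, h3⟩
    refine ⟨fun i => liftVel σ (p i) (u i), (hmot u).2 h1, fun i => ?_, ?_,
      fun h => h3 ((hB.exists_skew_liftVel_iff hpos).1 h)⟩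
    · rw [hB.form_lift_liftVel, sub_self, inner_zero_left, mul_zero]
    · rw [isSymmetric_starGroup_iff hΨ]
      refine ⟨fun x i => ?_, fun x i => ?_⟩
      · simp only [trunc_liftVel, map_smul, hp.height_eq, h2 x i]
      · simp only [liftVel_last, hp.height_eq, hp.inner_eq h2]

end IsQuadricModel

/-- The right-hand side does not involve `σ`, so this one equivalence links the finite flexes of all
three geometries. -/
theorem hasModelFlex_iff_hasSymmetricInfFlex [Fintype V] (hσ : σ = 0 ∨ σ = 1 ∨ σ = -1)
    {p : V → E d} (hpos : ∀ i, 0 < 1 + σ * ‖p i‖ ^ 2) (hreg : IsSRegular Φ p) :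
    HasModelFlex σ Φ p ↔ HasSymmetricInfFlex Φ p := by
  obtain ⟨hp, hmax⟩ := hreg
  obtain ⟨y₀, rfl⟩ : ∃ y₀ : symConfigs Φ, y₀.1 = p := ⟨⟨p, hp⟩, rfl⟩
  exact ⟨hasSymmetricInfFlex_of_hasModelFlex (by rcases hσ with rfl | rfl | rfl <;> norm_num),
    hasModelFlex_of_hasSymmetricInfFlex hσ hpos hmax⟩

end Transfer

theorem finite_edgeEnd {α β : Type*} (H : Graph α β) (hV : H.vertexSet.Finite)
    (hE : H.edgeSet.Finite) : Finite (EdgeEnd H) :=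
  (hV.prod (hE.prod (Set.finite_univ (α := Bool)))).subset
    (t := {z : α × β × Bool | H.Inc z.2.1 z.1 ∧ (z.2.2 = true → H.IsLoopAt z.2.1 z.1)})
    fun _ hz => ⟨hz.1.vertex_mem, hz.1.edge_mem, trivial⟩

end SymFramework

end

/-! ### The main theorem -/

theorem mainTheorem12 {α β : Type*} (H : Graph α β)
    (hV : H.vertexSet.Finite) (hE : H.edgeSet.Finite)
    (hdeg : ∀ v ∈ H.vertexSet, ∃ e, H.Inc e v)
    (d : ℕ) (S : Subgroup (SymFramework.E d ≃ₗᵢ[ℝ] SymFramework.E d))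
    (Φ : S →* (SymFramework.bodyBarGraph H ≃g SymFramework.bodyBarGraph H))
    (Ψq Ψr : SymFramework.starGroup S →*
      (SymFramework.bodyBarGraph H ≃g SymFramework.bodyBarGraph H))
    (p : SymFramework.EdgeEnd H → SymFramework.E d)
    (q r : SymFramework.EdgeEnd H → SymFramework.E (d + 1))
    (hp : SymFramework.IsFramework Φ p)
    (hq : SymFramework.IsFramework Ψq q) (hqS : ∀ i, q i ∈ SymFramework.hemisphere d)
    (hqp : ∀ i, SymFramework.centralProj d (q i) = p i)
    (hr : SymFramework.IsFramework Ψr r) (hrH : ∀ i, r i ∈ SymFramework.hyperbolicSpace d)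
    (hrp : ∀ i, SymFramework.centralProj d (r i) = p i) :
    [SymFramework.HasSymmetricInfFlex Φ p,
      SymFramework.HasSymmetricInfFlexOnSphere (SymFramework.euclidForm (d + 1)) Ψq q,
      SymFramework.HasSymmetricInfFlexOnSphere (SymFramework.minkForm d) Ψr r].TFAE ∧
    (SymFramework.IsSRegular Φ p →
      [SymFramework.HasSymmetricFiniteFlex Set.univ (SymFramework.euclidForm d) Φ p,
        SymFramework.HasSymmetricFiniteFlex (SymFramework.hemisphere d)
          (SymFramework.euclidForm (d + 1)) Ψq q,
        SymFramework.HasSymmetricFiniteFlex (SymFramework.hyperbolicSpace d)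
          (SymFramework.minkForm d) Ψr r].TFAE) := by
  have := SymFramework.finite_edgeEnd H hV hE
  have := Fintype.ofFinite (SymFramework.EdgeEnd H)
  have hS := SymFramework.isQuadricModel_hemisphere d
  have hH := SymFramework.isQuadricModel_hyperbolicSpace d
  have hΨq := SymFramework.type_eq_of_centralProj hp hq.2 hqp
  have hΨr := SymFramework.type_eq_of_centralProj hp hr.2 hrp
  refine ⟨?_, fun hreg => ?_⟩
  -- In both halves every entry of the list is rewritten to `HasSymmetricInfFlex Φ p`.
  · rw [List.tfae_cons_cons, List.tfae_cons_cons,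
      hS.hasSymmetricInfFlexOnSphere_iff hΨq hp.2 hqS hqp,
      hH.hasSymmetricInfFlexOnSphere_iff hΨr hp.2 hrH hrp]
    exact ⟨Iff.rfl, Iff.rfl, List.tfae_singleton _⟩
  · rw [List.tfae_cons_cons, List.tfae_cons_cons,
      SymFramework.hasSymmetricFiniteFlex_euclid_iff_hasModelFlex,
      SymFramework.hasSymmetricFiniteFlex_iff_hasModelFlex hS hΨq hqS hqp,
      SymFramework.hasSymmetricFiniteFlex_iff_hasModelFlex hH hΨr hrH hrp,
      SymFramework.hasModelFlex_iff_hasSymmetricInfFlex (Or.inl rfl) (by simp) hreg,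
      SymFramework.hasModelFlex_iff_hasSymmetricInfFlex (Or.inr (Or.inl rfl))
        (fun i => hqp i ▸ hS.pos_of_mem (hqS i)) hreg,
      SymFramework.hasModelFlex_iff_hasSymmetricInfFlex (Or.inr (Or.inr rfl))
        (fun i => hrp i ▸ hH.pos_of_mem (hrH i)) hreg]
    exact ⟨Iff.rfl, Iff.rfl, List.tfae_singleton _⟩
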